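/- A \emph{clutter} $\mathcal C$ over a finite ground set $V$ is a family of subsets of $V$ (its members), none of which contains another. A \emph{cover} is a subset of $V$ meeting every member; $\tau(\mathcal C)$ is the minimum cardinality of a cover; the \emph{blocker} $b(\mathcal C)$ is the clutter over $V$ of the inclusion-wise minimal covers. For disjoint $I,J\subseteq V$, the \emph{minor} $\mathcal C\setminus I/J$ is the clutter over $V-(I\cup J)$ of the inclusion-wise minimal sets in $\{C-J : C\in\mathcal C,\ C\cap I=\emptyset\}$. A \emph{delta} is a clutter over a ground set $\{a_1,\dots,a_n\}$, $n\ge 3$, with members $\{a_2,\dots,a_n\}$ and $\{a_1,a_i\}$, $i=2,\dots,n$. An \emph{extended odd hole} is a clutter over a ground set $\{a_1,\dots,a_n\}$, $n\ge5$ odd, whose members of minimum cardinality are $\{a_1,a_2\},\dots,\{a_{n-1},a_n\},\{a_n,a_1\}$. A clutter is \emph{clean} if no minor of it is a delta or the blocker of an extended odd hole. It is \emph{tangled} if $\tau(\mathcal C)=2$ and every element of $V$ belongs to a minimum cover. It is \emph{ideal} if the polyhedron $\{x\in\mathbb R^V_+ : \sum_{v\in C}x_v\ge1\ \ \forall C\in\mathcal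 C\}$ is integral, i.e. has only integral extreme points. For a tangled clutter $\mathcal C$, let $G(\mathcal C)$ be the graph on $V$ whose edges are the minimum covers, and let $\mathrm{rank}(\mathcal C)$ be its number of connected components. Let $\mathrm{core}(\mathcal C)$ be the clutter over $V$ of those members $C$ for which there is $y\in\mathbb R^{\mathcal C}_+$ with $\sum_{D\ni v}y_D\le1$ for all $v\in V$, $\sum_{D}y_D=2$ and $y_C>0$. For $S\subseteq\{0,1\}^n$, $\mathrm{cuboid}(S)$ is the clutter over $\{1,\dots,2n\}$ whose members have the incidence vectors $(p_1,1-p_1,\dots,p_n,1-p_n)$, $p\in S$. A \emph{duplication} of a clutter is obtained, up to relabeling elements, by repeatedly choosing an element $w$ and adding a new element $\bar w$ to the ground set and to every member containing $w$. A \emph{setcore} of $\mathcal C$ is a set $S\subseteq\{0,1\}^r$, $r=\mathrm{rank}(\mathcal C)$, such that $\mathrm{core}(\mathcal C)$ is a duplication of $\mathrm{cuboid}(S)$. Write $S\cong S'$ if $S'$ is obtained from $S$ by relabeling coordinates and complementing (modulo $2$) some coordinates. \textbf{Theorem.} Let $\mathcal C$ be a clean tangled clutter. Then $\mathcal C$ has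 a setcore. Moreover, for every setcore $S$ of $\mathcal C$ such that $\mathrm{conv}(S)$ is a simplex (the convex hull of finitely many, and at least one, affinely independent points), at least one of the following holds: (i) $\mathrm{rank}(\mathcal C)=1$ and $S=\{0,1\}$, and $\mathrm{core}(\mathcal C)$ consists of two (nonempty) members that partition the ground set; (ii) $S\cong\{000,110,101,011\}$, and $\mathrm{core}(\mathcal C)$ is a duplication of $Q_6=\{\{2,4,6\},\{1,3,6\},\{1,4,5\},\{2,3,5\}\}$ (a clutter over $\{1,\dots,6\}$); (iii) $\mathcal C$ is non-ideal. -/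

import Mathlib

/-- A clutter: a finite ground set together with a family of subsets of it, none of which contains
another one. The ground set is a finite set of elements of a type `α`, so that minors of a clutter
over `α` are again clutters over `α`. -/
structure Clutter (α : Type*) where
  ground : Finset α
  members : Finset (Finset α)
  subset_ground : ∀ A ∈ members, A ⊆ ground
  antichain : IsAntichain (· ⊆ ·) (members : Set (Finset α))

namespace Clutter

variable {α β : Type*} [DecidableEq α] [DecidableEq β]

/-- A cover: a set of elements that meets every member. -/
def IsCover (C : Clutter α) (B : Finset α) : Prop :=
  B ⊆ C.ground ∧ ∀ A ∈ C.members, (A ∩ B).Nonempty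

/-- The covering number `τ(C)`: the minimum cardinality of a cover (`⊤` if there is no cover,
which happens only if the empty set is a member). -/
noncomputable def coveringNumber (C : Clutter α) : ℕ∞ :=
  ⨅ (B : Finset α) (_ : C.IsCover B), (B.card : ℕ∞)

/-- A minimum cover: a cover of minimum cardinality. -/
def IsMinimumCover (C : Clutter α) (B : Finset α) : Prop :=
  C.IsCover B ∧ (B.card : ℕ∞) = C.coveringNumber

open Classical in
/-- The blocker `b(C)`: the clutter of the inclusion-wise minimal covers, over the same ground
set. -/
noncomputable def blocker (C : Clutter α) : Clutter α where
  ground := C.ground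
  members := C.ground.powerset.filter (fun B => Minimal C.IsCover B)
  subset_ground := by
    intro A hA
    exact Finset.mem_powerset.1 (Finset.mem_filter.1 hA).1
  antichain := by
    intro A hA B hB hne hAB
    have hA' := (Finset.mem_filter.1 (Finset.mem_coe.1 hA)).2
    have hB' := (Finset.mem_filter.1 (Finset.mem_coe.1 hB)).2
    exact hne (hB'.eq_of_le hA'.prop hAB)

/-- The sets `A - J`, where `A` is a member disjoint from `I`. -/
def minorFamily (C : Clutter α) (I J : Finset α) : Finset (Finset α) :=
  (C.members.filter (fun A => Disjoint A I)).image (fun A => A \ J)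

open Classical in
/-- The minor `C \ I / J` obtained after deleting `I` and contracting `J`: the clutter over
`V - (I ∪ J)` of the inclusion-wise minimal sets among the `A - J` with `A` a member disjoint
from `I`. -/
noncomputable def minor (C : Clutter α) (I J : Finset α) : Clutter α where
  ground := C.ground \ (I ∪ J)
  members := (C.minorFamily I J).filter (fun A => Minimal (fun B => B ∈ C.minorFamily I J) A)
  subset_ground := by
    intro A hA
    obtain ⟨B, hB, rfl⟩ := Finset.mem_image.1 (Finset.mem_filter.1 hA).1
    obtain ⟨hB, hBI⟩ := Finset.mem_filter.1 hB
    intro v hv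
    obtain ⟨hvB, hvJ⟩ := Finset.mem_sdiff.1 hv
    refine Finset.mem_sdiff.2 ⟨C.subset_ground B hB hvB, fun h => ?_⟩
    rcases Finset.mem_union.1 h with h | h
    · exact Finset.disjoint_left.1 hBI hvB h
    · exact hvJ h
  antichain := by
    intro A hA B hB hne hAB
    have hA' := (Finset.mem_filter.1 (Finset.mem_coe.1 hA)).2
    have hB' := (Finset.mem_filter.1 (Finset.mem_coe.1 hB)).2
    exact hne (hB'.eq_of_le hA'.prop hAB)

/-- `D` is a minor of `C`. -/
def IsMinorOf (D C : Clutter α) : Prop :=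
  ∃ I J : Finset α, I ⊆ C.ground ∧ J ⊆ C.ground ∧ Disjoint I J ∧ D = C.minor I J

/-- A delta: the ground set is `{a₁, …, aₙ}` with `n ≥ 3`, and the members are `{a₂, …, aₙ}` and
`{a₁, aᵢ}` for `i = 2, …, n`. Here `a = a₁`. -/
def IsDelta (C : Clutter α) : Prop :=
  3 ≤ C.ground.card ∧ ∃ a ∈ C.ground,
    C.members = insert (C.ground.erase a)
      ((C.ground.erase a).image (fun b => ({a, b} : Finset α)))

/-- An extended odd hole: the ground set is `{a₁, …, aₙ}` with `n ≥ 5` odd, and the members of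
minimum cardinality are `{a₁, a₂}, …, {aₙ₋₁, aₙ}, {aₙ, a₁}`. The indices are taken modulo `n`. -/
def IsExtendedOddHole (C : Clutter α) : Prop :=
  ∃ n : ℕ, 5 ≤ n ∧ Odd n ∧ ∃ a : ZMod n → α, Function.Injective a ∧
    (∀ v, v ∈ C.ground ↔ ∃ i, a i = v) ∧
    ∀ A : Finset α, (A ∈ C.members ∧ ∀ B ∈ C.members, A.card ≤ B.card) ↔
      ∃ i : ZMod n, A = {a i, a (i + 1)}

/-- A clutter is clean if it has no minor that is a delta or the blocker of an extended odd
hole. -/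
def IsClean (C : Clutter α) : Prop :=
  ∀ D : Clutter α, D.IsMinorOf C →
    ¬ D.IsDelta ∧ ¬ ∃ H : Clutter α, H.IsExtendedOddHole ∧ D = H.blocker

/-- A clutter is tangled if its covering number is two and every element belongs to a minimum
cover. -/
def IsTangled (C : Clutter α) : Prop :=
  C.coveringNumber = 2 ∧ ∀ v ∈ C.ground, ∃ B, C.IsMinimumCover B ∧ v ∈ B

/-- The graph `G(C)` on the ground set whose edges are the minimum covers (for a clutter with
covering number two). -/
def coverGraph (C : Clutter α) : SimpleGraph {v // v ∈ C.ground} where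
  Adj u v := u ≠ v ∧ C.IsMinimumCover {u.1, v.1}
  symm := ⟨fun u v h => ⟨h.1.symm, by rw [Finset.pair_comm]; exact h.2⟩⟩
  loopless := ⟨fun _ h => h.1 rfl⟩

/-- The rank of `C`: the number of connected components of `G(C)`. -/
noncomputable def rank (C : Clutter α) : ℕ :=
  Nat.card C.coverGraph.ConnectedComponent

/-- A fractional packing of `C`: nonnegative weights on the members such that the members
containing any given element have total weight at most one. Only the values of `y` at the members
are relevant. -/
def IsFractionalPacking (C : Clutter α) (y : Finset α → ℝ) : Prop :=
  (∀ A ∈ C.members, 0 ≤ y A) ∧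
    ∀ v ∈ C.ground, ∑ A ∈ C.members with v ∈ A, y A ≤ 1

open Classical in
/-- The core of `C`: the members that have positive weight in some fractional packing of value
two. -/
noncomputable def core (C : Clutter α) : Clutter α where
  ground := C.ground
  members := C.members.filter (fun A => ∃ y : Finset α → ℝ,
    C.IsFractionalPacking y ∧ ∑ B ∈ C.members, y B = 2 ∧ 0 < y A)
  subset_ground := fun A hA => C.subset_ground A (Finset.mem_filter.1 hA).1
  antichain := C.antichain.subset (by
    intro A hA
    exact (Finset.mem_filter.1 (Finset.mem_coe.1 hA)).1)

/-- `D` is, up to relabeling its elements, a duplication of `C`. The map `f` sends each element of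
`D` to the element of `C` of which it is a copy: the fibre of `f` over `w` consists of `w` and the
elements introduced by duplicating `w`, and a member of `C` is replaced by the set of all copies of
its elements. -/
def IsDuplicationOf (D : Clutter β) (C : Clutter α) : Prop :=
  ∃ f : β → α, D.ground.image f = C.ground ∧
    D.members = C.members.image (fun A => D.ground.filter (fun v => f v ∈ A))

/-- The cuboid of `S ⊆ {0,1}ⁿ`, with `0 = false` and `1 = true`. The elements `2i - 1` and `2i` of
the usual ground set `{1, …, 2n}` are written `(i, true)` and `(i, false)`: the member belonging to
`p ∈ S` contains the former if `pᵢ = 1` and the latter if `pᵢ = 0`. -/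
def cuboid {n : ℕ} (S : Finset (Fin n → Bool)) : Clutter (Fin n × Bool) where
  ground := Finset.univ
  members := S.image (fun p => Finset.univ.image (fun i => (i, p i)))
  subset_ground := fun _ _ => Finset.subset_univ _
  antichain := by
    intro A hA B hB hne hAB
    obtain ⟨p, _, rfl⟩ := Finset.mem_image.1 (Finset.mem_coe.1 hA)
    obtain ⟨q, _, rfl⟩ := Finset.mem_image.1 (Finset.mem_coe.1 hB)
    refine hne (congrArg (fun r : Fin n → Bool => Finset.univ.image (fun i => (i, r i))) ?_)
    funext i
    have h := hAB (Finset.mem_image.2 ⟨i, Finset.mem_univ i, rfl⟩)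
    obtain ⟨j, _, hj⟩ := Finset.mem_image.1 h
    have h1 : j = i := congrArg Prod.fst hj
    have h2 : q j = p i := congrArg Prod.snd hj
    rw [← h2, h1]

/-- The clutter `Q₆` over the ground set `{1, …, 6}`. -/
def Q6 : Clutter ℕ where
  ground := {1, 2, 3, 4, 5, 6}
  members := {{2, 4, 6}, {1, 3, 6}, {1, 4, 5}, {2, 3, 5}}
  subset_ground := by decide
  antichain := by
    have h : ∀ A ∈ ({{2, 4, 6}, {1, 3, 6}, {1, 4, 5}, {2, 3, 5}} : Finset (Finset ℕ)),
        ∀ B ∈ ({{2, 4, 6}, {1, 3, 6}, {1, 4, 5}, {2, 3, 5}} : Finset (Finset ℕ)),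
        A ⊆ B → A = B := by decide
    intro A hA B hB hne hAB
    exact hne (h A (Finset.mem_coe.1 hA) B (Finset.mem_coe.1 hB) hAB)

/-- `S ⊆ {0,1}^r`, with `r` the rank of `C`, is the setcore of `C` if the core of `C` is a
duplication of the cuboid of `S`. (For a clean tangled clutter such a set exists and is unique up
to isomorphism, that is, up to relabeling and twisting coordinates.) -/
def IsSetcore (C : Clutter α) (S : Finset (Fin C.rank → Bool)) : Prop :=
  C.core.IsDuplicationOf (cuboid S)

/-- The set covering polyhedron of `C`, in the space of real vectors indexed by the ground set. -/
def setCoveringPolyhedron (C : Clutter α) : Set ({v // v ∈ C.ground} → ℝ) :=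
  {x | (∀ v, 0 ≤ x v) ∧ ∀ A ∈ C.members, 1 ≤ ∑ v with v.1 ∈ A, x v}

/-- A clutter is ideal if its set covering polyhedron is integral, that is, all extreme points of
this (pointed) polyhedron have integer coordinates. -/
def IsIdeal (C : Clutter α) : Prop :=
  ∀ x ∈ Set.extremePoints ℝ C.setCoveringPolyhedron, ∀ v, ∃ z : ℤ, x v = z

end Clutter

/-- The convex hull in `ℝⁿ` of a set `S ⊆ {0,1}ⁿ`. -/
def cubeConvexHull {n : ℕ} (S : Finset (Fin n → Bool)) : Set (Fin n → ℝ) :=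
  convexHull ℝ ((fun p : Fin n → Bool => fun i => if p i then (1 : ℝ) else 0) '' (S : Set _))

/-- A simplex in `ℝⁿ`: the convex hull of finitely many, and at least one, affinely independent
points. -/
def IsSimplexSet {n : ℕ} (P : Set (Fin n → ℝ)) : Prop :=
  ∃ (m : ℕ) (s : Affine.Simplex ℝ (Fin n → ℝ) m), P = convexHull ℝ (Set.range s.points)

/-- Two sets of `0-1` points are isomorphic if one is obtained from the other after relabeling the
coordinates (by `e`) and twisting some coordinates (those `j` with `q j = 1`). -/
def CubeSetIso {n m : ℕ} (S : Finset (Fin n → Bool)) (T : Finset (Fin m → Bool)) : Prop :=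
  ∃ (e : Fin m ≃ Fin n) (q : Fin m → Bool), T = S.image (fun p j => xor (p (e j)) (q j))

/-! Existence of a setcore. The graph of minimum covers is bipartite: a shortest odd closed walk
would be an induced odd cycle, and contracting everything outside it gives a delta (length 3) or the
blocker of an extended odd hole (length at least 5). A core member meets every minimum cover exactly
once, so on each component it is one of the two colour classes. Recording the chosen class,
component by component, presents the core as a duplication of a cuboid.

Classification. Assume the clutter is ideal and conv(S) is a simplex. The barycentre of the minimum
covers is positive, has weight exactly 1 on the transversal members (those meeting each minimum
cover once) and more than 1 on all others. It may therefore be moved a little in any direction `d`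
that is nonnegative on transversal members, and ideality makes the new point dominate a convex
combination of covers (`IsIdeal.exists_perturbed_cover_combination`). Three choices of `d` carry the
proof. Arbitrary `d` gives an inequality which, by separation, puts every transversal member in the
core (`mem_core_iff_isTransversal`). The difference of two unit vectors shows that distinct
components are distinguished by core members, even up to complementation (`exists_core_separating`).
A `d` vanishing on all core members but one, which exists because conv(S) is a simplex, shows that
in a packing of value 2 supported on the core each weight is at least 1/2 or at least 1
(`half_le_of_separated`).

What remains is finite (`classification_of_weights`). The weights on each facet of the cube sum to
1. A weight of at least 1 leaves room only for an antipodal point, so the dimension is 1. Otherwise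
each facet contains exactly two points, so there are four points in all; separation of coordinates
bounds the dimension above by 3, and affine independence bounds it below by 3. -/

/-! ### Convex combinations and separating hyperplanes. -/

theorem exists_weights_of_mem_convexHull {ι κ : Type*} [DecidableEq κ] (s : Finset κ)
    (p : κ → ι → ℝ) {y : ι → ℝ} (hy : y ∈ convexHull ℝ (p '' (s : Set κ))) :
    ∃ ν : κ → ℝ, (∀ k ∈ s, 0 ≤ ν k) ∧ ∑ k ∈ s, ν k = 1 ∧ ∀ i, ∑ k ∈ s, ν k * p k i = y i := by
  suffices h : convexHull ℝ (p '' (s : Set κ)) ⊆ {y | ∃ ν : κ → ℝ, (∀ k ∈ s, 0 ≤ ν k) ∧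
      ∑ k ∈ s, ν k = 1 ∧ ∀ i, ∑ k ∈ s, ν k * p k i = y i} from h hy
  refine convexHull_min ?_ ?_
  · rintro _ ⟨k, hk, rfl⟩
    have hk : k ∈ s := hk
    refine ⟨Pi.single k 1, fun j _ => ?_, ?_, fun i => ?_⟩
    · by_cases h : j = k
      · subst h; simp
      · simp [h]
    · simp [hk]
    · simp [Pi.single_apply, hk]
  · rintro x ⟨ν, h0, h1, h2⟩ y ⟨μ, g0, g1, g2⟩ a b ha hb hab
    refine ⟨fun k => a * ν k + b * μ k, fun k hk => ?_, ?_, fun i => ?_⟩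
    · exact add_nonneg (mul_nonneg ha (h0 k hk)) (mul_nonneg hb (g0 k hk))
    · rw [Finset.sum_add_distrib, ← Finset.mul_sum, ← Finset.mul_sum, h1, g1, mul_one, mul_one,
        hab]
    · simp only [Pi.add_apply, Pi.smul_apply, smul_eq_mul, ← h2 i, ← g2 i, Finset.mul_sum,
        ← Finset.sum_add_distrib]
      exact Finset.sum_congr rfl fun k _ => by ring

theorem StrongDual.apply_eq_sum {ι : Type*} [Fintype ι] [DecidableEq ι]
    (f : StrongDual ℝ (ι → ℝ)) (y : ι → ℝ) :
    f y = ∑ i, f (Pi.single i 1) * y i := by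
  have h := LinearMap.pi_apply_eq_sum_univ f.toLinearMap y
  simp only [ContinuousLinearMap.coe_coe, smul_eq_mul] at h
  rw [h]
  refine Finset.sum_congr rfl fun i _ => ?_
  rw [mul_comm]
  congr 2
  funext j
  simp [Pi.single_apply, eq_comm]

/-- A point that satisfies all linear inequalities valid for finitely many points is a convex
combination of them. -/
theorem exists_convex_combination {ι κ : Type*} [Fintype ι] [DecidableEq κ] (s : Finset κ)
    (p : κ → ι → ℝ) (x : ι → ℝ)
    (h : ∀ (w : ι → ℝ) (u : ℝ), (∀ k ∈ s, u ≤ ∑ i, w i * p k i) → u ≤ ∑ i, w i * x i) :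
    ∃ ν : κ → ℝ, (∀ k ∈ s, 0 ≤ ν k) ∧ ∑ k ∈ s, ν k = 1 ∧ ∀ i, ∑ k ∈ s, ν k * p k i = x i := by
  classical
  by_contra hcon
  have hx : x ∉ convexHull ℝ (p '' (s : Set κ)) :=
    fun hx => hcon (exists_weights_of_mem_convexHull s p hx)
  obtain ⟨f, u, hfx, hfp⟩ := geometric_hahn_banach_point_closed (convex_convexHull ℝ _)
    ((s.finite_toSet.image p).isCompact_convexHull ℝ).isClosed hx
  have := h (fun i => f (Pi.single i 1)) u fun k hk => by
    rw [← f.apply_eq_sum]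
    exact (hfp _ (subset_convexHull ℝ _ ⟨k, hk, rfl⟩)).le
  rw [← f.apply_eq_sum] at this
  exact absurd hfx this.not_gt

/-- A point that satisfies all inequalities with nonnegative coefficients valid for finitely many
points dominates a convex combination of them. -/
theorem exists_dominated_convex_combination {ι κ : Type*} [Fintype ι] [DecidableEq κ]
    (s : Finset κ) (p : κ → ι → ℝ) (x : ι → ℝ)
    (h : ∀ (w : ι → ℝ) (u : ℝ), (∀ i, 0 ≤ w i) → (∀ k ∈ s, u ≤ ∑ i, w i * p k i) →
      u ≤ ∑ i, w i * x i) :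
    ∃ ν : κ → ℝ, (∀ k ∈ s, 0 ≤ ν k) ∧ ∑ k ∈ s, ν k = 1 ∧ ∀ i, ∑ k ∈ s, ν k * p k i ≤ x i := by
  classical
  by_contra hcon
  -- Separating the whole orthant below `x`, rather than `x` alone, forces the separating functional
  -- to have nonnegative coefficients.
  have hx : Disjoint (Set.Iic x) (convexHull ℝ (p '' (s : Set κ))) := by
    refine Set.disjoint_left.2 fun y hyx hy => hcon ?_
    obtain ⟨ν, h0, h1, h2⟩ := exists_weights_of_mem_convexHull s p hy
    exact ⟨ν, h0, h1, fun i => (h2 i).le.trans (hyx i)⟩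
  obtain ⟨f, u, v, hfx, huv, hfp⟩ := geometric_hahn_banach_closed_compact (convex_Iic x)
    isClosed_Iic (convex_convexHull ℝ _) ((s.finite_toSet.image p).isCompact_convexHull ℝ) hx
  have hf : ∀ i, 0 ≤ f (Pi.single i 1) := by
    intro i
    by_contra! hneg
    -- If a coefficient were negative, going down far enough along its axis would stay in the
    -- orthant and bring the functional up to `u`.
    obtain ⟨t, ht0, ht⟩ : ∃ t : ℝ, 0 ≤ t ∧ u ≤ f x - t * f (Pi.single i 1) := by
      refine ⟨(u - f x) / (- f (Pi.single i 1)), ?_, ?_⟩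
      · exact div_nonneg (sub_nonneg.2 (hfx x Set.self_mem_Iic).le) (by linarith)
      · have hne : f (Pi.single i 1) ≠ 0 := hneg.ne
        field_simp
        linarith
    have h1 := hfx (x - t • Pi.single i 1) (by
      refine Set.mem_Iic.2 (sub_le_self _ (smul_nonneg ht0 ?_))
      exact Pi.single_nonneg.2 zero_le_one)
    rw [map_sub, map_smul, smul_eq_mul] at h1
    linarith
  have := h (fun i => f (Pi.single i 1)) v hf fun k hk => by
    rw [← f.apply_eq_sum]
    exact (hfp _ (subset_convexHull ℝ _ ⟨k, hk, rfl⟩)).le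
  rw [← f.apply_eq_sum] at this
  linarith [hfx x Set.self_mem_Iic]

/-! ### The set covering polyhedron of an ideal clutter. -/

namespace Clutter

variable {α : Type*} [DecidableEq α]

theorem isClosed_setCoveringPolyhedron (C : Clutter α) : IsClosed C.setCoveringPolyhedron := by
  have : C.setCoveringPolyhedron = (⋂ v, {x | 0 ≤ x v}) ∩
      ⋂ A ∈ C.members, {x | 1 ≤ ∑ v with v.1 ∈ A, x v} := by
    ext x
    simp [setCoveringPolyhedron]
  rw [this]
  refine (isClosed_iInter fun v => ?_).inter (isClosed_biInter fun A _ => ?_)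
  · exact isClosed_le continuous_const (by fun_prop)
  · exact isClosed_le continuous_const (by fun_prop)

/-- A linear function with positive coefficients attains its minimum over the set covering
polyhedron at an extreme point. -/
theorem exists_extremePoint_minimizer (C : Clutter α) {x : {v // v ∈ C.ground} → ℝ}
    (hx : x ∈ C.setCoveringPolyhedron) {w : {v // v ∈ C.ground} → ℝ} (hw : ∀ v, 0 < w v) :
    ∃ e ∈ Set.extremePoints ℝ C.setCoveringPolyhedron,
      ∑ v, w v * e v ≤ ∑ v, w v * x v := by
  set Q := C.setCoveringPolyhedron with hQ
  let g : ({v // v ∈ C.ground} → ℝ) → ℝ := fun y => ∑ v, w v * y v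
  have hg : Continuous g := by fun_prop
  have hcomp : IsCompact (Q ∩ {y | g y ≤ g x}) := by
    refine IsCompact.of_isClosed_subset
      (isCompact_univ_pi fun v => isCompact_Icc (a := (0 : ℝ)) (b := g x / w v))
      (C.isClosed_setCoveringPolyhedron.inter (isClosed_le hg continuous_const)) ?_
    rintro y ⟨hy, hyx⟩ v -
    refine ⟨hy.1 v, (le_div_iff₀ (hw v)).2 ?_⟩
    rw [mul_comm]
    refine le_trans ?_ hyx
    exact Finset.single_le_sum (f := fun v => w v * y v)
      (fun u _ => mul_nonneg (hw u).le (hy.1 u)) (Finset.mem_univ v)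
  obtain ⟨m, hmQ, hm⟩ := hcomp.exists_isMinOn ⟨x, hx, le_refl (g x)⟩ hg.continuousOn
  have hmin : ∀ y ∈ Q, g m ≤ g y := by
    intro y hy
    by_cases h : g y ≤ g x
    · exact hm ⟨hy, h⟩
    · exact hmQ.2.trans (not_le.1 h).le
  -- The minimizers form a compact face: an extreme point of the face is extreme in the whole
  -- polyhedron.
  have hFcomp : IsCompact (Q ∩ {y | g y ≤ g m}) := by
    refine hcomp.of_isClosed_subset
      (C.isClosed_setCoveringPolyhedron.inter (isClosed_le hg continuous_const)) ?_
    exact fun y hy => ⟨hy.1, (show g y ≤ g m from hy.2).trans hmQ.2⟩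
  obtain ⟨e, he⟩ := hFcomp.extremePoints_nonempty ⟨m, hmQ.1, le_refl (g m)⟩
  rw [mem_extremePoints] at he
  refine ⟨e, mem_extremePoints.2 ⟨he.1.1, fun y hy z hz heyz => ?_⟩, le_trans he.1.2 hmQ.2⟩
  obtain ⟨a, b, ha, hb, hab, rfl⟩ := heyz
  have hcomb : g (a • y + b • z) = a * g y + b * g z := by
    simp only [g, Pi.add_apply, Pi.smul_apply, smul_eq_mul, Finset.mul_sum,
      ← Finset.sum_add_distrib]
    exact Finset.sum_congr rfl fun v _ => by ring
  have h1 : a * g y + b * g z ≤ g m := hcomb ▸ he.1.2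
  have hb' : b = 1 - a := by linarith
  have hay := mul_le_mul_of_nonneg_left (hmin y hy) ha.le
  have hbz := mul_le_mul_of_nonneg_left (hmin z hz) hb.le
  have hsum : a * g m + b * g m = g m := by rw [← add_mul, hab, one_mul]
  refine he.2 y ⟨hy, ?_⟩ z ⟨hz, ?_⟩ ⟨a, b, ha, hb, hab, rfl⟩
  · exact le_of_mul_le_mul_left (by linarith) ha
  · exact le_of_mul_le_mul_left (by linarith) hb

open Classical in
/-- The finite set of all covers. -/
noncomputable def covers (C : Clutter α) : Finset (Finset α) :=
  C.ground.powerset.filter C.IsCover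

theorem mem_covers {C : Clutter α} {B : Finset α} : B ∈ C.covers ↔ C.IsCover B := by
  classical
  simp only [covers, Finset.mem_filter, Finset.mem_powerset, and_iff_right_iff_imp]
  exact fun h => h.1

theorem sum_subtype_ground (C : Clutter α) (f : α → ℝ) {A : Finset α} (hA : A ⊆ C.ground) :
    ∑ v : {v // v ∈ C.ground} with v.1 ∈ A, f v = ∑ v ∈ A, f v := by
  rw [Finset.sum_filter]
  rw [Finset.sum_coe_sort C.ground (fun v => if v ∈ A then f v else 0), ← Finset.sum_filter,
    Finset.filter_mem_eq_inter, Finset.inter_eq_right.2 hA]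

/-- Every point of the set covering polyhedron of an ideal clutter dominates a convex combination
of covers. -/
theorem IsIdeal.exists_cover_combination {C : Clutter α} (hC : C.IsIdeal) {x : α → ℝ}
    (hx0 : ∀ v ∈ C.ground, 0 ≤ x v) (hx : ∀ A ∈ C.members, 1 ≤ ∑ v ∈ A, x v) :
    ∃ ν : Finset α → ℝ, (∀ B ∈ C.covers, 0 ≤ ν B) ∧ ∑ B ∈ C.covers, ν B = 1 ∧
      ∀ v ∈ C.ground, ∑ B ∈ C.covers with v ∈ B, ν B ≤ x v := by
  classical
  have hxQ : (fun v : {v // v ∈ C.ground} => x v) ∈ C.setCoveringPolyhedron := by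
    refine ⟨fun v => hx0 v v.2, fun A hA => ?_⟩
    rw [C.sum_subtype_ground x (C.subset_ground A hA)]
    exact hx A hA
  obtain ⟨ν, h0, h1, h2⟩ := exists_dominated_convex_combination C.covers
    (fun B (v : {v // v ∈ C.ground}) => if v.1 ∈ B then (1 : ℝ) else 0) (fun v => x v) (by
      intro w u hw hu
      by_contra! hlt
      set X : ℝ := ∑ v : {v // v ∈ C.ground}, x v with hX
      have hX0 : 0 ≤ X := Finset.sum_nonneg fun v _ => hx0 v v.2
      -- A minimizer at an extreme point is only available for strictly positive coefficients, so
      -- `w` is raised by an `η` small enough to keep the strict inequality.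
      obtain ⟨η, hη0, hη⟩ : ∃ η : ℝ, 0 < η ∧
          ∑ v : {v // v ∈ C.ground}, w v * x v + η * X < u := by
        refine ⟨(u - ∑ v : {v // v ∈ C.ground}, w v * x v) / (X + 1),
          div_pos (by linarith) (by linarith), ?_⟩
        have : (u - ∑ v : {v // v ∈ C.ground}, w v * x v) / (X + 1) * X <
            u - ∑ v : {v // v ∈ C.ground}, w v * x v := by
          rw [div_mul_eq_mul_div, div_lt_iff₀ (by linarith)]
          exact mul_lt_mul_of_pos_left (by linarith) (by linarith)
        linarith
      obtain ⟨e, he, hle⟩ := C.exists_extremePoint_minimizer hxQ (w := fun v => w v + η)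
        fun v => add_pos_of_nonneg_of_pos (hw v) hη0
      have heQ := he.1
      -- By integrality `e` vanishes off `B` and is at least 1 on it, so `B` is a cover whose
      -- incidence vector lies below `e`.
      let B : Finset α := C.ground.filter fun v => ∃ h : v ∈ C.ground, 1 ≤ e ⟨v, h⟩
      have hint : ∀ v, v.1 ∉ B → e v = 0 := by
        intro v hv
        obtain ⟨z, hz⟩ := hC e he v
        have h0 := heQ.1 v
        have h1 : ¬ 1 ≤ e v := fun h => hv (Finset.mem_filter.2 ⟨v.2, v.2, h⟩)
        rw [hz] at h0 h1 ⊢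
        norm_cast at h0 h1 ⊢
        omega
      have hB : C.IsCover B := by
        refine ⟨Finset.filter_subset _ _, fun A hA => ?_⟩
        by_contra hne
        have h1 := heQ.2 A hA
        rw [Finset.sum_eq_zero] at h1
        · linarith
        · intro v hv
          refine hint v fun hvB => hne ⟨v, Finset.mem_inter.2 ⟨(Finset.mem_filter.1 hv).2, hvB⟩⟩
      have hBu := hu B (mem_covers.2 hB)
      have h3 : ∑ v : {v // v ∈ C.ground}, w v * (if v.1 ∈ B then (1 : ℝ) else 0) ≤
          ∑ v, (w v + η) * e v := by
        refine Finset.sum_le_sum fun v _ => ?_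
        split_ifs with hv
        · obtain ⟨_, _, h⟩ := Finset.mem_filter.1 hv
          nlinarith [hw v]
        · rw [mul_zero]
          exact mul_nonneg (add_nonneg (hw v) hη0.le) (heQ.1 v)
      have h4 : ∑ v : {v // v ∈ C.ground}, (w v + η) * x v =
          ∑ v : {v // v ∈ C.ground}, w v * x v + η * X := by
        simp only [add_mul, Finset.sum_add_distrib, hX, Finset.mul_sum]
      linarith)
  refine ⟨ν, h0, h1, fun v hv => ?_⟩
  have := h2 ⟨v, hv⟩
  simpa [Finset.sum_filter] using this

end Clutter

/-! ### Tangled clutters: perturbing the barycentre of the minimum covers. -/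

open Filter Topology

/-- Double counting of incidences between elements and sets; used for covers and for packings alike.
-/
theorem sum_sum_filter_mem_mul {α : Type*} [DecidableEq α] (F : Finset (Finset α))
    (ν : Finset α → ℝ) (X : Finset α) (g : α → ℝ) :
    ∑ v ∈ X, (∑ B ∈ F with v ∈ B, ν B) * g v = ∑ B ∈ F, ν B * ∑ v ∈ B ∩ X, g v := by
  simp_rw [Finset.sum_mul, Finset.mul_sum, Finset.sum_filter]
  rw [Finset.sum_comm]
  refine Finset.sum_congr rfl fun B _ => ?_
  rw [Finset.inter_comm, ← Finset.filter_mem_eq_inter, Finset.sum_filter]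

theorem sum_sum_filter_mem {α : Type*} [DecidableEq α] (F : Finset (Finset α))
    (ν : Finset α → ℝ) (X : Finset α) :
    ∑ v ∈ X, ∑ B ∈ F with v ∈ B, ν B = ∑ B ∈ F, ν B * ((B ∩ X).card : ℝ) := by
  simpa using sum_sum_filter_mem_mul F ν X fun _ => 1

namespace Clutter

variable {α : Type*} [DecidableEq α] {C : Clutter α}

theorem IsTangled.two_le_card (h : C.IsTangled) {B : Finset α} (hB : C.IsCover B) :
    2 ≤ B.card := by
  have : C.coveringNumber ≤ (B.card : ℕ∞) := iInf₂_le B hB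
  rw [h.1] at this
  exact_mod_cast this

theorem IsTangled.isMinimumCover_iff (h : C.IsTangled) {B : Finset α} :
    C.IsMinimumCover B ↔ C.IsCover B ∧ B.card = 2 := by
  unfold IsMinimumCover
  rw [h.1]
  norm_cast

theorem IsTangled.ground_nonempty (h : C.IsTangled) : C.ground.Nonempty := by
  by_contra hne
  rw [Finset.not_nonempty_iff_eq_empty] at hne
  have h1 : ∃ B, C.IsCover B := by
    by_contra! hno
    have : C.coveringNumber = ⊤ := by simp [coveringNumber, hno]
    rw [h.1] at this
    exact absurd this (by decide)
  obtain ⟨B, hB⟩ := h1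
  have h2 := h.two_le_card hB
  have hB1 := hB.1
  rw [hne, Finset.subset_empty] at hB1
  rw [hB1] at h2
  simp at h2

open Classical in
/-- The finite set of minimum covers. -/
noncomputable def minimumCovers (C : Clutter α) : Finset (Finset α) :=
  C.ground.powerset.filter C.IsMinimumCover

theorem mem_minimumCovers {B : Finset α} : B ∈ C.minimumCovers ↔ C.IsMinimumCover B := by
  simp only [minimumCovers, Finset.mem_filter, Finset.mem_powerset, and_iff_right_iff_imp]
  exact fun h => h.1.1

theorem IsTangled.minimumCovers_nonempty (h : C.IsTangled) : C.minimumCovers.Nonempty := by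
  obtain ⟨v, hv⟩ := h.ground_nonempty
  obtain ⟨B, hB, -⟩ := h.2 v hv
  exact ⟨B, mem_minimumCovers.2 hB⟩

/-- A transversal member: a member that meets every minimum cover in exactly one element. -/
def IsTransversal (C : Clutter α) (A : Finset α) : Prop :=
  A ∈ C.members ∧ ∀ B, C.IsMinimumCover B → (A ∩ B).card = 1

/-- The barycentre of the incidence vectors of the minimum covers. -/
noncomputable def coverBarycenter (C : Clutter α) (v : α) : ℝ :=
  ∑ B ∈ C.minimumCovers with v ∈ B, (C.minimumCovers.card : ℝ)⁻¹

theorem IsTangled.coverBarycenter_pos (h : C.IsTangled) {v : α} (hv : v ∈ C.ground) :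
    0 < C.coverBarycenter v := by
  obtain ⟨B, hB, hvB⟩ := h.2 v hv
  have := Finset.card_pos.2 h.minimumCovers_nonempty
  exact Finset.sum_pos (fun _ _ => by positivity)
    ⟨B, Finset.mem_filter.2 ⟨mem_minimumCovers.2 hB, hvB⟩⟩

theorem sum_coverBarycenter (X : Finset α) :
    ∑ v ∈ X, C.coverBarycenter v =
      ∑ B ∈ C.minimumCovers, (C.minimumCovers.card : ℝ)⁻¹ * ((B ∩ X).card : ℝ) :=
  sum_sum_filter_mem _ _ _

theorem IsTangled.sum_inv_card (h : C.IsTangled) :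
    ∑ _B ∈ C.minimumCovers, (C.minimumCovers.card : ℝ)⁻¹ = 1 := by
  have := Finset.card_pos.2 h.minimumCovers_nonempty
  rw [Finset.sum_const, nsmul_eq_mul, mul_inv_cancel₀ (by positivity)]

theorem IsTangled.sum_coverBarycenter_ground (h : C.IsTangled) :
    ∑ v ∈ C.ground, C.coverBarycenter v = 2 := by
  rw [sum_coverBarycenter, ← mul_one (2 : ℝ), ← h.sum_inv_card, Finset.mul_sum]
  refine Finset.sum_congr rfl fun B hB => ?_
  have hB := h.isMinimumCover_iff.1 (mem_minimumCovers.1 hB)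
  rw [Finset.inter_eq_left.2 hB.1.1, hB.2, mul_comm]
  norm_num

theorem IsTangled.sum_coverBarycenter_transversal (h : C.IsTangled) {A : Finset α}
    (hA : C.IsTransversal A) : ∑ v ∈ A, C.coverBarycenter v = 1 := by
  rw [sum_coverBarycenter, ← h.sum_inv_card]
  refine Finset.sum_congr rfl fun B hB => ?_
  rw [Finset.inter_comm, hA.2 B (mem_minimumCovers.1 hB), Nat.cast_one, mul_one]

/-- The strict slack here is what leaves room for perturbation: only transversal members are tight
at the barycentre. -/
theorem IsTangled.one_lt_sum_coverBarycenter (h : C.IsTangled) {A : Finset α}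
    (hA : A ∈ C.members) (hA' : ¬ C.IsTransversal A) : 1 < ∑ v ∈ A, C.coverBarycenter v := by
  have hpos := Finset.card_pos.2 h.minimumCovers_nonempty
  obtain ⟨B, hB, hne⟩ : ∃ B, C.IsMinimumCover B ∧ (A ∩ B).card ≠ 1 := by
    by_contra! hcon
    exact hA' ⟨hA, hcon⟩
  rw [sum_coverBarycenter, ← h.sum_inv_card]
  have hone : ∀ D, C.IsMinimumCover D → 1 ≤ (D ∩ A).card := fun D hD => by
    rw [Finset.inter_comm]
    exact Finset.card_pos.2 (hD.1.2 A hA)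
  refine Finset.sum_lt_sum (fun D hD => ?_) ⟨B, mem_minimumCovers.2 hB, ?_⟩
  · refine le_mul_of_one_le_right (by positivity) ?_
    exact_mod_cast hone D (mem_minimumCovers.1 hD)
  · refine lt_mul_of_one_lt_right (by positivity) ?_
    rw [Finset.inter_comm] at hne
    exact_mod_cast lt_of_le_of_ne (hone B hB) hne.symm

/-- If `d` has nonnegative total weight on every transversal member, then moving a little from the
barycentre of the minimum covers in the direction of `d` one stays in the set covering
polyhedron. -/
theorem IsTangled.exists_perturbation (h : C.IsTangled) {d : α → ℝ}
    (hd : ∀ A, C.IsTransversal A → 0 ≤ ∑ v ∈ A, d v) :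
    ∃ δ : ℝ, 0 < δ ∧ (∀ v ∈ C.ground, 0 ≤ C.coverBarycenter v + δ * d v) ∧
      ∀ A ∈ C.members, 1 ≤ ∑ v ∈ A, (C.coverBarycenter v + δ * d v) := by
  have h1 : ∀ᶠ δ : ℝ in 𝓝[>] 0, ∀ v ∈ C.ground, 0 ≤ C.coverBarycenter v + δ * d v := by
    rw [Filter.eventually_all_finset]
    intro v hv
    have hc : Continuous fun δ : ℝ => C.coverBarycenter v + δ * d v := by fun_prop
    have := (hc.tendsto 0).eventually_const_lt (u := 0)
      (by simpa using h.coverBarycenter_pos hv)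
    exact (this.filter_mono nhdsWithin_le_nhds).mono fun _ h => h.le
  have h2 : ∀ᶠ δ : ℝ in 𝓝[>] 0, ∀ A ∈ C.members,
      1 ≤ ∑ v ∈ A, (C.coverBarycenter v + δ * d v) := by
    rw [Filter.eventually_all_finset]
    intro A hA
    by_cases hAT : C.IsTransversal A
    · filter_upwards [self_mem_nhdsWithin] with δ hδ
      rw [Finset.sum_add_distrib, h.sum_coverBarycenter_transversal hAT, ← Finset.mul_sum]
      exact le_add_of_nonneg_right (mul_nonneg (Set.mem_Ioi.1 hδ).le (hd A hAT))
    · have hc : Continuous fun δ : ℝ => ∑ v ∈ A, (C.coverBarycenter v + δ * d v) := by fun_prop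
      have := (hc.tendsto 0).eventually_const_lt (u := 1)
        (by simpa using h.one_lt_sum_coverBarycenter hA hAT)
      exact (this.filter_mono nhdsWithin_le_nhds).mono fun _ h => h.le
  obtain ⟨δ, ⟨h1, h2⟩, h3⟩ := ((h1.and h2).and self_mem_nhdsWithin).exists
  exact ⟨δ, h3, h1, h2⟩

theorem IsIdeal.exists_perturbed_cover_combination (hC : C.IsIdeal) (h : C.IsTangled) {d : α → ℝ}
    (hd : ∀ A, C.IsTransversal A → 0 ≤ ∑ v ∈ A, d v) :
    ∃ δ : ℝ, 0 < δ ∧ ∃ ν : Finset α → ℝ, (∀ B ∈ C.covers, 0 ≤ ν B) ∧ ∑ B ∈ C.covers, ν B = 1 ∧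
      ∀ v ∈ C.ground, ∑ B ∈ C.covers with v ∈ B, ν B ≤ C.coverBarycenter v + δ * d v := by
  obtain ⟨δ, hδ, h0, h1⟩ := h.exists_perturbation hd
  exact ⟨δ, hδ, hC.exists_cover_combination h0 h1⟩

theorem IsCover.inter_ground {B : Finset α} (hB : C.IsCover B) : B ∩ C.ground = B :=
  Finset.inter_eq_left.2 hB.1

/-- The perturbed point dominates a combination of covers. Minimum covers contribute exactly 1 on
`A`, and any excess on `A` must come from larger covers or from the slack of the domination; both
are paid for by the excess of the total weight over 2, which is at most `δ` times the total of `d`.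
-/
theorem IsTangled.sum_transversal_le (h : C.IsTangled) (hC : C.IsIdeal) {d : α → ℝ}
    (hd : ∀ A, C.IsTransversal A → 0 ≤ ∑ v ∈ A, d v) {A : Finset α} (hA : C.IsTransversal A) :
    ∑ v ∈ A, d v ≤ (C.ground.card + 1) * ∑ v ∈ C.ground, d v := by
  obtain ⟨δ, hδ, ν, h0, h1, h2⟩ := hC.exists_perturbed_cover_combination h hd
  set c : α → ℝ := fun v => ∑ B ∈ C.covers with v ∈ B, ν B with hc
  set x : α → ℝ := fun v => C.coverBarycenter v + δ * d v with hx
  have hxsum : ∀ X, ∑ v ∈ X, x v = ∑ v ∈ X, C.coverBarycenter v + δ * ∑ v ∈ X, d v := by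
    intro X
    rw [Finset.mul_sum, Finset.sum_add_distrib]
  have hxA := hxsum A
  rw [h.sum_coverBarycenter_transversal hA] at hxA
  have hxV := hxsum C.ground
  rw [h.sum_coverBarycenter_ground] at hxV
  have hAV := C.subset_ground A hA.1
  have hcA : ∑ v ∈ A, c v = ∑ B ∈ C.covers, ν B * ((B ∩ A).card : ℝ) := sum_sum_filter_mem _ _ _
  have hcV : ∑ v ∈ C.ground, c v = ∑ B ∈ C.covers, ν B * (B.card : ℝ) := by
    rw [hc, sum_sum_filter_mem]
    exact Finset.sum_congr rfl fun B hB => by rw [(mem_covers.1 hB).inter_ground]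
  have hgap : ∑ v ∈ A, (x v - c v) ≤ ∑ v ∈ C.ground, (x v - c v) :=
    Finset.sum_le_sum_of_subset_of_nonneg hAV fun v hv _ => sub_nonneg.2 (h2 v hv)
  rw [Finset.sum_sub_distrib, Finset.sum_sub_distrib] at hgap
  have hcV2 : 2 ≤ ∑ v ∈ C.ground, c v := by
    rw [hcV, ← mul_one (2 : ℝ), ← h1, Finset.mul_sum]
    refine Finset.sum_le_sum fun B hB => ?_
    rw [mul_comm]
    refine mul_le_mul_of_nonneg_left ?_ (h0 B hB)
    exact_mod_cast h.two_le_card (mem_covers.1 hB)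
  have hcVx : ∑ v ∈ C.ground, c v ≤ ∑ v ∈ C.ground, x v := Finset.sum_le_sum h2
  -- For each cover `B`, |B ∩ A| ≤ 1 + |V|(|B| - 2): this is an equality if |B| = 2, and otherwise
  -- |B| - 2 ≥ 1 and |B ∩ A| ≤ |V|.
  have hcAV : ∑ v ∈ A, c v ≤ 1 + C.ground.card * (∑ v ∈ C.ground, c v - 2) := by
    have : ∑ B ∈ C.covers, ν B * ((B ∩ A).card : ℝ) ≤
        ∑ B ∈ C.covers, ν B * (1 + C.ground.card * ((B.card : ℝ) - 2)) := by
      refine Finset.sum_le_sum fun B hB => mul_le_mul_of_nonneg_left ?_ (h0 B hB)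
      have hB := mem_covers.1 hB
      have hle : (B ∩ A).card ≤ C.ground.card :=
        Finset.card_le_card (Finset.inter_subset_left.trans hB.1)
      rcases (h.two_le_card hB).eq_or_lt with h3 | h3
      · rw [Finset.inter_comm, hA.2 B (h.isMinimumCover_iff.2 ⟨hB, h3.symm⟩), ← h3]
        norm_num
      · have h3 : (3 : ℝ) ≤ B.card := by exact_mod_cast h3
        have hle : ((B ∩ A).card : ℝ) ≤ C.ground.card := by exact_mod_cast hle
        nlinarith [(Nat.cast_nonneg C.ground.card : (0 : ℝ) ≤ _)]
    rw [hcA]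
    refine this.trans_eq ?_
    rw [hcV, Finset.sum_congr rfl fun B _ => show ν B * (1 + C.ground.card * ((B.card : ℝ) - 2)) =
      ν B + C.ground.card * (ν B * B.card - 2 * ν B) by ring, Finset.sum_add_distrib, h1,
      ← Finset.mul_sum, Finset.sum_sub_distrib, ← Finset.mul_sum, h1, mul_one]
  have hn : (0 : ℝ) ≤ C.ground.card := Nat.cast_nonneg _
  have hcV3 := mul_le_mul_of_nonneg_left hcVx hn
  have : δ * ∑ v ∈ A, d v ≤ δ * ((C.ground.card + 1) * ∑ v ∈ C.ground, d v) := by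
    rw [hxV] at hcV3 hgap
    rw [hxA] at hgap
    linarith
  exact le_of_mul_le_mul_left this hδ

/-- Two elements of the ground set that lie in the same transversal members of an ideal tangled
clutter are not separated by any function that sums to zero on each minimum cover. -/
theorem IsTangled.eq_of_mem_transversal_iff (h : C.IsTangled) (hC : C.IsIdeal) {a b : α}
    (ha : a ∈ C.ground) (hb : b ∈ C.ground)
    (hab : ∀ A, C.IsTransversal A → (a ∈ A ↔ b ∈ A)) {g : α → ℝ}
    (hg : ∀ B, C.IsMinimumCover B → ∑ v ∈ B, g v = 0) : g a = g b := by
  -- This direction has sum zero on every transversal member and on the ground set, so the perturbed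
  -- point still has total weight 2. The dominated combination then equals that point and uses
  -- minimum covers only, and pairing with `g` yields the claim.
  let d : α → ℝ := fun v => (if v = a then 1 else 0) - if v = b then 1 else 0
  obtain ⟨δ, hδ, ν, h0, h1, h2⟩ := hC.exists_perturbed_cover_combination h (d := d) (by
    intro A hA
    simp [d, Finset.sum_sub_distrib, hab A hA])
  set c : α → ℝ := fun v => ∑ B ∈ C.covers with v ∈ B, ν B with hc
  have hdV : ∑ v ∈ C.ground, d v = 0 := by simp [d, Finset.sum_sub_distrib, ha, hb]
  have hxV : ∑ v ∈ C.ground, (C.coverBarycenter v + δ * d v) = 2 := by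
    rw [Finset.sum_add_distrib, ← Finset.mul_sum, hdV, h.sum_coverBarycenter_ground, mul_zero,
      add_zero]
  have hcV : ∑ v ∈ C.ground, c v = ∑ B ∈ C.covers, ν B * (B.card : ℝ) := by
    rw [hc, sum_sum_filter_mem]
    exact Finset.sum_congr rfl fun B hB => by rw [(mem_covers.1 hB).inter_ground]
  have hle : ∀ B ∈ C.covers, ν B * 2 ≤ ν B * (B.card : ℝ) := by
    intro B hB
    refine mul_le_mul_of_nonneg_left ?_ (h0 B hB)
    exact_mod_cast h.two_le_card (mem_covers.1 hB)
  have hsum2 : ∑ B ∈ C.covers, ν B * 2 = 2 := by rw [← Finset.sum_mul, h1, one_mul]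
  have hcx := Finset.sum_le_sum h2
  have hcV2 : ∑ v ∈ C.ground, c v = 2 := by
    refine le_antisymm (hcx.trans_eq hxV) ?_
    rw [hcV, ← hsum2]
    exact Finset.sum_le_sum hle
  have hceq := (Finset.sum_eq_sum_iff_of_le h2).1 (hcV2.trans hxV.symm)
  have hνeq := (Finset.sum_eq_sum_iff_of_le hle).1 (hsum2.trans (hcV2.symm.trans hcV))
  have hgc : ∑ v ∈ C.ground, c v * g v = 0 := by
    rw [hc, sum_sum_filter_mem_mul]
    refine Finset.sum_eq_zero fun B hB => ?_
    by_cases hνB : ν B = 0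
    · rw [hνB, zero_mul]
    · have hcard := mul_left_cancel₀ hνB (hνeq B hB)
      have hB := mem_covers.1 hB
      rw [hB.inter_ground, hg B (h.isMinimumCover_iff.2 ⟨hB, by exact_mod_cast hcard.symm⟩),
        mul_zero]
  have hgx : ∑ v ∈ C.ground, C.coverBarycenter v * g v = 0 := by
    unfold coverBarycenter
    rw [sum_sum_filter_mem_mul]
    refine Finset.sum_eq_zero fun B hB => ?_
    have hB := mem_minimumCovers.1 hB
    rw [hB.1.inter_ground, hg B hB, mul_zero]
  have hgd : ∑ v ∈ C.ground, d v * g v = g a - g b := by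
    simp [d, sub_mul, Finset.sum_sub_distrib, ha, hb]
  have : ∑ v ∈ C.ground, c v * g v = ∑ v ∈ C.ground, C.coverBarycenter v * g v +
      δ * ∑ v ∈ C.ground, d v * g v := by
    rw [Finset.mul_sum, ← Finset.sum_add_distrib]
    refine Finset.sum_congr rfl fun v hv => ?_
    have hcv : c v = C.coverBarycenter v + δ * d v := hceq v hv
    rw [hcv]
    ring
  rw [hgc, hgx, hgd, zero_add] at this
  have := (mul_eq_zero.1 this.symm).resolve_left hδ.ne'
  linarith

theorem mem_core {A : Finset α} : A ∈ C.core.members ↔ A ∈ C.members ∧ ∃ y : Finset α → ℝ,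
    C.IsFractionalPacking y ∧ ∑ B ∈ C.members, y B = 2 ∧ 0 < y A := by
  simp [core]

/-- For a minimum cover `B`, the total 2 is at most the sum of y_A |A ∩ B|, which is the load on `B`
and hence at most 2. Equality holds throughout, and the minimum covers exhaust the ground set. -/
theorem IsTangled.load_eq_one (h : C.IsTangled) {y : Finset α → ℝ}
    (hy : C.IsFractionalPacking y) (hy2 : ∑ A ∈ C.members, y A = 2) :
    (∀ A ∈ C.members, y A ≠ 0 → C.IsTransversal A) ∧
      ∀ v ∈ C.ground, ∑ A ∈ C.members with v ∈ A, y A = 1 := by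
  have key : ∀ B, C.IsMinimumCover B →
      (∀ A ∈ C.members, y A * 1 = y A * ((A ∩ B).card : ℝ)) ∧
        ∀ v ∈ B, ∑ A ∈ C.members with v ∈ A, y A = 1 := by
    intro B hB
    have hB2 := h.isMinimumCover_iff.1 hB
    have hload : ∀ v ∈ B, ∑ A ∈ C.members with v ∈ A, y A ≤ 1 := fun v hv => hy.2 v (hB.1.1 hv)
    have hle : ∀ A ∈ C.members, y A * 1 ≤ y A * ((A ∩ B).card : ℝ) := by
      intro A hA
      refine mul_le_mul_of_nonneg_left ?_ (hy.1 A hA)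
      exact_mod_cast Finset.card_pos.2 (hB.1.2 A hA)
    have h1 := Finset.sum_le_sum hload
    have h2 := Finset.sum_le_sum hle
    have h3 : ∑ v ∈ B, (1 : ℝ) = 2 := by simp [hB2.2]
    rw [← sum_sum_filter_mem] at h2
    simp only [mul_one] at h2
    constructor
    · refine (Finset.sum_eq_sum_iff_of_le hle).1 ?_
      rw [← sum_sum_filter_mem]
      simp only [mul_one]
      linarith
    · refine (Finset.sum_eq_sum_iff_of_le hload).1 ?_
      linarith
  refine ⟨fun A hA hyA => ⟨hA, fun B hB => ?_⟩, fun v hv => ?_⟩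
  · exact_mod_cast (mul_left_cancel₀ hyA ((key B hB).1 A hA)).symm
  · obtain ⟨B, hB, hvB⟩ := h.2 v hv
    exact (key B hB).2 v hvB

theorem IsTangled.isTransversal_of_mem_core (h : C.IsTangled) {A : Finset α}
    (hA : A ∈ C.core.members) : C.IsTransversal A := by
  obtain ⟨hA, y, hy, hy2, hyA⟩ := mem_core.1 hA
  exact (h.load_eq_one hy hy2).1 A hA hyA.ne'

/-- In an ideal tangled clutter every transversal member belongs to the core. -/
theorem IsTangled.mem_core_iff_isTransversal (h : C.IsTangled) (hC : C.IsIdeal) {A : Finset α} :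
    A ∈ C.core.members ↔ C.IsTransversal A := by
  classical
  refine ⟨h.isTransversal_of_mem_core, fun hA => ?_⟩
  -- The constant of `sum_transversal_le`.
  set n : ℝ := C.ground.card + 1 with hn
  have hn1 : 1 ≤ n := by simp [hn]
  have hs : 0 < 2 * n - 1 := by linarith
  let T := C.members.filter C.IsTransversal
  have hT : ∀ {D}, D ∈ T ↔ C.IsTransversal D := fun {D} =>
    ⟨fun hD => (Finset.mem_filter.1 hD).2, fun hD => Finset.mem_filter.2 ⟨hD.1, hD⟩⟩
  obtain ⟨E, hE⟩ := h.minimumCovers_nonempty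
  have hE := mem_minimumCovers.1 hE
  have hE2 := (h.isMinimumCover_iff.1 hE).2
  -- The target is chosen so that 2n - 1 times it, plus the incidence vector of `A`, is constantly
  -- n. Dividing by n then gives load 1 everywhere and total (1 + (2n - 1))/n = 2, with positive
  -- weight on `A`.
  obtain ⟨μ, h0, h1, h2⟩ := exists_convex_combination T
    (fun D (v : {v // v ∈ C.ground}) => if v.1 ∈ D then (1 : ℝ) else 0)
    (fun v => (n - if v.1 ∈ A then 1 else 0) / (2 * n - 1)) (by
      intro w u hw
      let w' : α → ℝ := fun v => if hv : v ∈ C.ground then w ⟨v, hv⟩ else 0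
      have hw' : ∀ D ⊆ C.ground, ∑ v ∈ D, w' v = ∑ v : {v // v ∈ C.ground}, w v *
          if v.1 ∈ D then (1 : ℝ) else 0 := by
        intro D hD
        rw [← C.sum_subtype_ground w' hD, Finset.sum_filter]
        refine Finset.sum_congr rfl fun v _ => ?_
        simp [w']
      -- Every transversal member meets `E` exactly once, so subtracting `u` on `E` turns the affine
      -- condition w(D) ≥ u into d(D) ≥ 0.
      let d : α → ℝ := fun v => w' v - if v ∈ E then u else 0
      have hd : ∀ X, ∑ v ∈ X, d v = ∑ v ∈ X, w' v - ((X ∩ E).card : ℝ) * u := by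
        intro X
        simp [d, Finset.sum_sub_distrib]
      have hdT : ∀ D, C.IsTransversal D → ∑ v ∈ D, d v = ∑ v ∈ D, w' v - u := by
        intro D hD
        rw [hd, hD.2 E hE, Nat.cast_one, one_mul]
      have hle := h.sum_transversal_le hC (d := d) (fun D hD => by
        rw [hdT D hD, hw' D (C.subset_ground D hD.1), sub_nonneg]
        exact hw D (hT.2 hD)) hA
      rw [hdT A hA, hd, Finset.inter_eq_right.2 hE.1.1, hE2, hw' A (C.subset_ground A hA.1),
        hw' _ subset_rfl] at hle
      have : ∑ v : {v // v ∈ C.ground}, w v * ((n - if v.1 ∈ A then 1 else 0) / (2 * n - 1)) =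
          (n * ∑ v : {v // v ∈ C.ground}, w v * (if v.1 ∈ C.ground then (1 : ℝ) else 0) -
            ∑ v : {v // v ∈ C.ground}, w v * if v.1 ∈ A then (1 : ℝ) else 0) / (2 * n - 1) := by
        rw [Finset.mul_sum, ← Finset.sum_sub_distrib, Finset.sum_div]
        refine Finset.sum_congr rfl fun v _ => ?_
        rw [if_pos v.2]
        ring
      rw [this, le_div_iff₀ hs]
      push_cast at hle
      linarith)
  have hn0 : n ≠ 0 := by linarith
  let y : Finset α → ℝ := fun D =>
    ((if D = A then 1 else 0) + (2 * n - 1) * if D ∈ T then μ D else 0) / n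
  have hy0 : ∀ D, 0 ≤ y D := by
    intro D
    refine div_nonneg (add_nonneg (by split_ifs <;> norm_num) (mul_nonneg hs.le ?_)) (by linarith)
    split_ifs with hD
    · exact h0 D hD
    · exact le_rfl
  have hTsub : T ⊆ C.members := Finset.filter_subset _ _
  refine mem_core.2 ⟨hA.1, y, ⟨fun D _ => hy0 D, fun v hv => ?_⟩, ?_, ?_⟩
  · have h2v := h2 ⟨v, hv⟩
    simp only [mul_ite, mul_one, mul_zero] at h2v
    rw [eq_div_iff hs.ne'] at h2v
    have e1 : ∑ D ∈ C.members with v ∈ D, (if D = A then (1 : ℝ) else 0) =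
        if v ∈ A then 1 else 0 := by
      rw [Finset.sum_ite_eq']
      simp [hA.1]
    have e2 : ∑ D ∈ C.members with v ∈ D, (if D ∈ T then μ D else 0) =
        ∑ D ∈ T, if v ∈ D then μ D else 0 := by
      rw [Finset.sum_filter, ← Finset.sum_subset hTsub]
      · exact Finset.sum_congr rfl fun D hD => by simp [hD]
      · intro D _ hD
        simp [hD]
    simp only [y]
    rw [← Finset.sum_div, Finset.sum_add_distrib, ← Finset.mul_sum, e1, e2,
      div_le_one (by linarith)]
    linarith
  · simp only [y]
    rw [← Finset.sum_div, Finset.sum_add_distrib, ← Finset.mul_sum, Finset.sum_ite_eq',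
      if_pos hA.1, Finset.sum_ite_mem, Finset.inter_eq_right.2 hTsub, h1]
    field_simp
    ring
  · refine div_pos (add_pos_of_pos_of_nonneg (by simp) (mul_nonneg hs.le ?_)) (by linarith)
    rw [if_pos (hT.2 hA)]
    exact h0 A (hT.2 hA)

end Clutter

/-! ### Lower bounds for the weights of a packing supported on the core. -/

namespace Clutter

variable {α : Type*} [DecidableEq α] {C : Clutter α}

/-- A clutter with nonempty core has a fractional packing of value two whose support is the
core. -/
theorem exists_packing_pos_iff_mem_core (hne : C.core.members.Nonempty) :
    ∃ y : Finset α → ℝ, C.IsFractionalPacking y ∧ ∑ A ∈ C.members, y A = 2 ∧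
      ∀ A ∈ C.members, 0 < y A ↔ A ∈ C.core.members := by
  -- Each core member has a packing of value two that is positive on it; their average is positive
  -- on all of them.
  choose! z hz hz2 hzpos using fun A (hA : A ∈ C.core.members) => (mem_core.1 hA).2
  set n : ℝ := (C.core.members.card : ℝ) with hn
  have hn0 : 0 < n := by
    rw [hn]
    exact_mod_cast Finset.card_pos.2 hne
  have hsum : ∀ F : Finset (Finset α), ∑ A ∈ F, n⁻¹ * ∑ D ∈ C.core.members, z D A =
      n⁻¹ * ∑ D ∈ C.core.members, ∑ A ∈ F, z D A := by
    intro F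
    rw [← Finset.mul_sum, Finset.sum_comm]
  have hpack : C.IsFractionalPacking fun A => n⁻¹ * ∑ D ∈ C.core.members, z D A := by
    refine ⟨fun A hA => mul_nonneg (inv_nonneg.2 hn0.le)
      (Finset.sum_nonneg fun D hD => (hz D hD).1 A hA), fun v hv => ?_⟩
    rw [hsum, inv_mul_le_iff₀ hn0, mul_one, hn, ← nsmul_one, ← Finset.sum_const]
    exact Finset.sum_le_sum fun D hD => (hz D hD).2 v hv
  have hval : ∑ A ∈ C.members, n⁻¹ * ∑ D ∈ C.core.members, z D A = 2 := by
    rw [hsum, Finset.sum_congr rfl hz2, Finset.sum_const, nsmul_eq_mul,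
      inv_mul_cancel_left₀ hn0.ne']
  refine ⟨_, hpack, hval, fun A hA => ⟨fun h => mem_core.2 ⟨hA, _, hpack, hval, h⟩, fun hAc => ?_⟩⟩
  refine mul_pos (inv_pos.2 hn0) ?_
  exact Finset.sum_pos' (fun D hD => (hz D hD).1 A hA) ⟨A, hAc, hzpos A hAc⟩

/-- If some linear function vanishes on all members of the core of an ideal tangled clutter except
for one, then that member has weight at least one half. -/
theorem IsTangled.half_le_of_separated (h : C.IsTangled) (hC : C.IsIdeal) {y : Finset α → ℝ}
    (hy : C.IsFractionalPacking y) (hy2 : ∑ A ∈ C.members, y A = 2)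
    (hysupp : ∀ A ∈ C.members, 0 < y A ↔ A ∈ C.core.members) {A : Finset α}
    (hA : A ∈ C.core.members) (hyA : y A < 1) {d : α → ℝ}
    (hd : ∀ D ∈ C.core.members, ∑ v ∈ D, d v = if D = A then 1 else 0) :
    1 / 2 ≤ y A := by
  have hAm := (mem_core.1 hA).1
  have hyA0 := (hysupp A hAm).2 hA
  have hload := (h.load_eq_one hy hy2).2
  -- An element covered by `A` alone among core members would have load at most `y A` < 1, contrary
  -- to `load_eq_one`.
  have hother : ∀ v ∈ C.ground, ∃ D ∈ C.core.members, D ≠ A ∧ v ∈ D := by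
    intro v hv
    by_contra! hno
    have hle : ∑ D ∈ C.members with v ∈ D, y D ≤ ∑ D ∈ C.members, if D = A then y A else 0 := by
      rw [Finset.sum_filter]
      refine Finset.sum_le_sum fun D hD => ?_
      by_cases hDA : D = A
      · rw [if_pos hDA, hDA]
        split_ifs
        · exact le_rfl
        · exact hyA0.le
      · rw [if_neg hDA]
        split_ifs with hvD
        · by_contra! hpos
          exact hno D ((hysupp D hD).1 hpos) hDA hvD
        · exact le_rfl
    rw [hload v hv, Finset.sum_ite_eq', if_pos hAm] at hle
    linarith
  obtain ⟨δ, hδ, ν, h0, h1, h2⟩ := hC.exists_perturbed_cover_combination h (d := d) (by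
    intro D hD
    rw [hd D ((h.mem_core_iff_isTransversal hC).2 hD)]
    split_ifs <;> norm_num)
  set c : α → ℝ := fun v => ∑ B ∈ C.covers with v ∈ B, ν B with hc
  set x : α → ℝ := fun v => C.coverBarycenter v + δ * d v with hx
  have hxsum : ∀ D ∈ C.core.members, ∑ v ∈ D, x v = 1 + δ * if D = A then 1 else 0 := by
    intro D hD
    rw [Finset.sum_add_distrib, ← Finset.mul_sum, hd D hD,
      h.sum_coverBarycenter_transversal (h.isTransversal_of_mem_core hD)]
  have hcsum : ∀ D, ∑ v ∈ D, c v = ∑ B ∈ C.covers, ν B * ((B ∩ D).card : ℝ) :=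
    fun D => sum_sum_filter_mem _ _ _
  have hνsum : ∑ B ∈ C.covers, ν B * 1 = 1 := by simpa using h1
  have hmeet : ∀ D ∈ C.members, ∀ B ∈ C.covers, ν B * 1 ≤ ν B * ((B ∩ D).card : ℝ) := by
    intro D hD B hB
    refine mul_le_mul_of_nonneg_left ?_ (h0 B hB)
    rw [Finset.inter_comm]
    exact_mod_cast Finset.card_pos.2 ((mem_covers.1 hB).2 D hD)
  -- The perturbed point has weight exactly 1 on `D`, so both the domination and the covering
  -- inequalities are tight there. By `hother` the domination is then tight on all of `A` too.
  have htight : ∀ D ∈ C.core.members, D ≠ A →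
      (∀ v ∈ D, c v = x v) ∧ ∀ B ∈ C.covers, ν B * 1 = ν B * ((B ∩ D).card : ℝ) := by
    intro D hD hDA
    have hDm := (mem_core.1 hD).1
    have hle : ∀ v ∈ D, c v ≤ x v := fun v hv => h2 v (C.subset_ground D hDm hv)
    have e1 := Finset.sum_le_sum hle
    have e2 := Finset.sum_le_sum (hmeet D hDm)
    have e3 := hxsum D hD
    rw [if_neg hDA, mul_zero, add_zero] at e3
    have e4 := hcsum D
    exact ⟨(Finset.sum_eq_sum_iff_of_le hle).1 (by linarith),
      (Finset.sum_eq_sum_iff_of_le (hmeet D hDm)).1 (by linarith)⟩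
  have hcA : ∑ v ∈ A, c v = 1 + δ := by
    have hxA := hxsum A hA
    rw [if_pos rfl, mul_one] at hxA
    rw [← hxA]
    refine Finset.sum_congr rfl fun v hv => ?_
    obtain ⟨D, hD, hDA, hvD⟩ := hother v (C.subset_ground A hAm hv)
    exact (htight D hD hDA).1 v hvD
  obtain ⟨B, hB, hνB, hBA⟩ : ∃ B ∈ C.covers, ν B ≠ 0 ∧ 2 ≤ (B ∩ A).card := by
    by_contra! hno
    have : ∑ B ∈ C.covers, ν B * ((B ∩ A).card : ℝ) ≤ ∑ B ∈ C.covers, ν B * 1 := by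
      refine Finset.sum_le_sum fun B hB => ?_
      by_cases hνB : ν B = 0
      · simp [hνB]
      · refine mul_le_mul_of_nonneg_left ?_ (h0 B hB)
        exact_mod_cast Nat.lt_succ_iff.1 (hno B hB hνB)
    rw [← hcsum, hcA] at this
    linarith
  have hBc := mem_covers.1 hB
  -- Count |B| through the unit loads: `B` meets each core member other than `A` exactly once.
  have hcard : (B.card : ℝ) = 2 + y A * ((B ∩ A).card - 1) := by
    have e1 : ∑ v ∈ B, ∑ D ∈ C.members with v ∈ D, y D = B.card := by
      rw [Finset.sum_congr rfl fun v hv => hload v (hBc.1 hv)]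
      simp
    rw [← e1, sum_sum_filter_mem, ← hy2]
    have e2 : ∀ D ∈ C.members, y D * ((D ∩ B).card : ℝ) =
        y D + if D = A then y A * (((B ∩ A).card : ℝ) - 1) else 0 := by
      intro D hD
      by_cases hDA : D = A
      · subst hDA
        rw [if_pos rfl, Finset.inter_comm]
        ring
      · rw [if_neg hDA, add_zero]
        by_cases hDc : D ∈ C.core.members
        · rw [Finset.inter_comm, ← mul_left_cancel₀ hνB ((htight D hDc hDA).2 B hB), mul_one]
        · have : y D = 0 := le_antisymm (not_lt.1 fun hp => hDc ((hysupp D hD).1 hp)) (hy.1 D hD)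
          rw [this, zero_mul]
    rw [Finset.sum_congr rfl e2, Finset.sum_add_distrib, Finset.sum_ite_eq', if_pos hAm]
  have hle : (B ∩ A).card ≤ B.card := Finset.card_le_card Finset.inter_subset_left
  have hBA' : (2 : ℝ) ≤ (B ∩ A).card := by exact_mod_cast hBA
  have hlt : B.card < (B ∩ A).card + 1 := by
    have : (B.card : ℝ) < (B ∩ A).card + 1 := by
      rw [hcard]
      nlinarith
    exact_mod_cast this
  -- So `B` lies inside `A`. With k = |B| the count reads k = 2 + y_A (k - 1); k = 2 would give y_A
  -- = 0, hence k ≥ 3 and y_A = (k - 2)/(k - 1) ≥ 1/2.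
  have heq : B.card = (B ∩ A).card := by omega
  rw [heq] at hcard
  have h3 : 3 ≤ (B ∩ A).card := by
    by_contra! hlt3
    have : (B ∩ A).card = 2 := by omega
    rw [this] at hcard
    norm_num at hcard
    linarith
  have h3 : (3 : ℝ) ≤ (B ∩ A).card := by exact_mod_cast h3
  by_contra! hlt
  nlinarith

end Clutter

/-! ### Bipartiteness and induced odd cycles. -/

namespace SimpleGraph

variable {V : Type*} {G : SimpleGraph V}

/-- Colour by the parity of a walk from the root of the component. An edge with equally coloured
ends would close up two such walks to an odd one. -/
theorem exists_two_coloring (h : ∀ u, ∀ p : G.Walk u u, ¬ Odd p.length) :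
    ∃ c : V → Bool, ∀ u v, G.Adj u v → c u ≠ c v := by
  classical
  have hr : ∀ v, G.Reachable (G.connectedComponentMk v).out v := fun v =>
    ConnectedComponent.exact (Quot.out_eq _)
  choose p hp using fun v => (hr v).exists_walk_length_eq_dist
  refine ⟨fun v => decide (Odd (p v).length), fun u v huv => ?_⟩
  have hcomp : (G.connectedComponentMk v).out = (G.connectedComponentMk u).out := by
    rw [ConnectedComponent.sound huv.reachable]
  have hodd := h _ (((p u).concat huv).append ((p v).copy hcomp rfl).reverse)
  rw [Walk.length_append, Walk.length_concat, Walk.length_reverse, Walk.length_copy] at hodd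
  rw [ne_eq, decide_eq_decide]
  intro hiff
  refine hodd ?_
  by_cases h1 : Odd (p u).length
  · exact (h1.add_odd odd_one).add_odd (hiff.1 h1)
  · have h2 : ¬ Odd (p v).length := fun h2 => h1 (hiff.2 h2)
    rw [Nat.not_odd_iff_even] at h1 h2
    exact (h1.add_one).add_even h2

/-- A graph with an odd closed walk has an induced odd cycle. -/
theorem exists_induced_odd_cycle {u : V} (p : G.Walk u u) (hp : Odd p.length) :
    ∃ n, Odd n ∧ 3 ≤ n ∧ ∃ a : ℕ → V, (∀ i < n, G.Adj (a i) (a (i + 1))) ∧ a n = a 0 ∧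
      (∀ i j, i < j → j < n → a i ≠ a j) ∧
      ∀ i j, i < j → j < n → G.Adj (a i) (a j) → j = i + 1 ∨ (i = 0 ∧ j = n - 1) := by
  classical
  -- Take an odd closed walk of minimum length. Two of its positions cut it into two arcs of
  -- opposite parity, so a repeated vertex or a chord yields a shorter odd closed walk.
  have hex : ∃ n, Odd n ∧ ∃ (v : V) (q : G.Walk v v), q.length = n := ⟨_, hp, u, p, rfl⟩
  obtain ⟨hodd, v, q, hq⟩ := Nat.find_spec hex
  have hmin : ∀ {w : V} (r : G.Walk w w), Odd r.length → Nat.find hex ≤ r.length :=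
    fun r hr => Nat.find_min' hex ⟨hr, _, r, rfl⟩
  set n := Nat.find hex with hn
  have hadj : ∀ i < n, G.Adj (q.getVert i) (q.getVert (i + 1)) :=
    fun i hi => q.adj_getVert_succ (by omega)
  have h0 : q.getVert n = q.getVert 0 := by
    rw [← hq, q.getVert_length, q.getVert_zero]
  have hin : ∀ i j, i ≤ j → j ≤ n →
      ∃ r : G.Walk (q.getVert i) (q.getVert j), r.length = j - i := by
    intro i j hij hjn
    have e : (q.drop i).getVert (j - i) = q.getVert j := by
      rw [Walk.drop_getVert, Nat.add_sub_cancel' hij]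
    refine ⟨((q.drop i).take (j - i)).copy rfl e, ?_⟩
    rw [Walk.length_copy, Walk.take_length, Walk.drop_length]
    omega
  have hout : ∀ i j, i ≤ j → j ≤ n →
      ∃ r : G.Walk (q.getVert j) (q.getVert i), r.length = n - (j - i) := by
    intro i j hij hjn
    refine ⟨(q.drop j).append (q.take i), ?_⟩
    rw [Walk.length_append, Walk.take_length, Walk.drop_length]
    omega
  have hinj : ∀ i j, i < j → j < n → q.getVert i ≠ q.getVert j := by
    intro i j hij hjn heq
    obtain ⟨r, hr⟩ := hin i j hij.le hjn.le
    obtain ⟨s, hs⟩ := hout i j hij.le hjn.le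
    have hr' := hmin (r.copy rfl heq.symm)
    have hs' := hmin (s.copy rfl heq)
    rw [Walk.length_copy, hr] at hr'
    rw [Walk.length_copy, hs] at hs'
    have hsum : Odd ((j - i) + (n - (j - i))) := by
      rwa [Nat.add_sub_cancel' (by omega)]
    rcases Nat.even_or_odd (j - i) with he | ho
    · have := hs' (by
        rw [add_comm] at hsum
        exact (Nat.odd_add.1 hsum).2 he)
      omega
    · have := hr' ho
      omega
  refine ⟨n, hodd, ?_, q.getVert, hadj, h0, hinj, ?_⟩
  · by_contra! hlt
    have h1 : n = 1 := by
      obtain ⟨k, hk⟩ := hodd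
      omega
    have := hadj 0 (by omega)
    rw [← h0, h1] at this
    exact G.loopless.irrefl _ this
  · intro i j hij hjn hGij
    obtain ⟨r, hr⟩ := hin i j hij.le hjn.le
    obtain ⟨s, hs⟩ := hout i j hij.le hjn.le
    have hr' := hmin (r.concat hGij.symm)
    have hs' := hmin (s.concat hGij)
    rw [Walk.length_concat, hr] at hr'
    rw [Walk.length_concat, hs] at hs'
    obtain ⟨k, hk⟩ := hodd
    -- The chord closes the even arc to an odd walk, which minimality forces to have length at least
    -- n: the other arc is a single edge.
    rcases Nat.even_or_odd (j - i) with he | ho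
    · have := hr' he.add_one
      omega
    · have : Odd (n - (j - i) + 1) := by
        obtain ⟨l, hl⟩ := ho
        exact ⟨k - l, by omega⟩
      have := hs' this
      omega

end SimpleGraph

/-! ### Contractions of clean clutters and odd cycles of minimum covers. -/

namespace Clutter

variable {α : Type*} [DecidableEq α] {C : Clutter α}

theorem eq_of_ground_eq_of_members_eq {β : Type*} {C D : Clutter β} (h1 : C.ground = D.ground)
    (h2 : C.members = D.members) : C = D := by
  cases C
  cases D
  simp_all

theorem mem_blocker {B : Finset α} : B ∈ C.blocker.members ↔ Minimal C.IsCover B := by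
  simp only [blocker, Finset.mem_filter, Finset.mem_powerset, and_iff_right_iff_imp]
  exact fun h => h.prop.1

theorem IsCover.exists_mem_blocker {B : Finset α} (hB : C.IsCover B) :
    ∃ M ∈ C.blocker.members, M ⊆ B := by
  classical
  obtain ⟨M, hMB, hM⟩ := C.covers.exists_le_minimal (mem_covers.2 hB)
  refine ⟨M, mem_blocker.2 ?_, hMB⟩
  simpa only [mem_covers] using hM

/-- Blocking is an involution. -/
theorem blocker_blocker (C : Clutter α) : C.blocker.blocker = C := by
  have hcov : ∀ A ∈ C.members, C.blocker.IsCover A := by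
    refine fun A hA => ⟨C.subset_ground A hA, fun B hB => ?_⟩
    rw [Finset.inter_comm]
    exact (mem_blocker.1 hB).prop.2 A hA
  have hsub : ∀ Z, C.blocker.IsCover Z → ∃ A ∈ C.members, A ⊆ Z := by
    intro Z hZ
    by_contra! hno
    -- If `Z` contained no member, its complement would be a cover, and a minimal cover inside it
    -- would miss `Z`.
    have hc : C.IsCover (C.ground \ Z) := by
      refine ⟨Finset.sdiff_subset, fun A hA => ?_⟩
      obtain ⟨v, hvA, hvZ⟩ := Finset.not_subset.1 (hno A hA)
      exact ⟨v, by simp [hvA, hvZ, C.subset_ground A hA hvA]⟩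
    obtain ⟨M, hM, hMZ⟩ := hc.exists_mem_blocker
    obtain ⟨v, hv⟩ := hZ.2 M hM
    rw [Finset.mem_inter] at hv
    exact (Finset.mem_sdiff.1 (hMZ hv.1)).2 hv.2
  refine eq_of_ground_eq_of_members_eq rfl (Finset.ext fun A => ?_)
  rw [mem_blocker]
  constructor
  · intro hA
    obtain ⟨A', hA', hle⟩ := hsub A hA.prop
    rwa [← hA.eq_of_le (hcov A' hA') hle]
  · intro hA
    refine ⟨hcov A hA, fun Z hZ hZA => ?_⟩
    obtain ⟨A', hA', hle⟩ := hsub Z hZ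
    have : A' = A := by
      by_contra hne
      exact C.antichain hA' hA hne (hle.trans hZA)
    exact this ▸ hle

/-- The minor obtained by contracting everything outside `X`. -/
noncomputable def contractTo (C : Clutter α) (X : Finset α) : Clutter α :=
  C.minor ∅ (C.ground \ X)

theorem contractTo_isMinorOf (X : Finset α) : (C.contractTo X).IsMinorOf C :=
  ⟨∅, C.ground \ X, Finset.empty_subset _, Finset.sdiff_subset, Finset.disjoint_empty_left _, rfl⟩

theorem contractTo_ground {X : Finset α} (hX : X ⊆ C.ground) : (C.contractTo X).ground = X := by
  simp [contractTo, minor, hX]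

theorem mem_contractTo_members {X M : Finset α} : M ∈ (C.contractTo X).members ↔
    Minimal (fun N => ∃ A ∈ C.members, A ∩ X = N) M := by
  have hfam : ∀ N, N ∈ C.minorFamily ∅ (C.ground \ X) ↔ ∃ A ∈ C.members, A ∩ X = N := by
    intro N
    have : ∀ A ∈ C.members, A \ (C.ground \ X) = A ∩ X := by
      intro A hA
      ext v
      have : v ∈ A → v ∈ C.ground := fun hv => C.subset_ground A hA hv
      simp only [Finset.mem_sdiff, Finset.mem_inter]
      tauto
    simp only [minorFamily, Finset.disjoint_empty_right, Finset.filter_true, Finset.mem_image]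
    exact ⟨fun ⟨A, hA, h⟩ => ⟨A, hA, (this A hA).symm.trans h⟩,
      fun ⟨A, hA, h⟩ => ⟨A, hA, (this A hA).trans h⟩⟩
  simp only [contractTo, minor, Finset.mem_filter, hfam]
  exact ⟨fun h => h.2, fun h => ⟨h.prop, h⟩⟩

theorem contractTo_isCover {X : Finset α} (hX : X ⊆ C.ground) {B : Finset α} :
    (C.contractTo X).IsCover B ↔ B ⊆ X ∧ C.IsCover B := by
  classical
  unfold IsCover
  rw [contractTo_ground hX]
  constructor
  · rintro ⟨hBX, hB⟩
    refine ⟨hBX, hBX.trans hX, fun A hA => ?_⟩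
    obtain ⟨M, hMA, hM⟩ := (C.members.image (· ∩ X)).exists_le_minimal
      (Finset.mem_image_of_mem (· ∩ X) hA)
    obtain ⟨v, hv⟩ := hB M (mem_contractTo_members.2 (by simpa only [Finset.mem_image] using hM))
    rw [Finset.mem_inter] at hv
    exact ⟨v, Finset.mem_inter.2 ⟨(Finset.mem_inter.1 (hMA hv.1)).1, hv.2⟩⟩
  · rintro ⟨hBX, -, hB⟩
    refine ⟨hBX, fun M hM => ?_⟩
    obtain ⟨A, hA, rfl⟩ := (mem_contractTo_members.1 hM).prop
    obtain ⟨v, hv⟩ := hB A hA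
    rw [Finset.mem_inter] at hv
    exact ⟨v, by simp [hv.1, hv.2, hBX hv.2]⟩

/-- The three covers make each member contain two of the three elements. No element lies in all
members, since the covering number is two, so each of the three pairs occurs as a trace. -/
theorem IsTangled.isDelta_contractTo (h : C.IsTangled) {p q r : α} (hpq : p ≠ q) (hpr : p ≠ r)
    (hqr : q ≠ r) (h1 : C.IsCover {p, q}) (h2 : C.IsCover {p, r}) (h3 : C.IsCover {q, r}) :
    (C.contractTo {p, q, r}).IsDelta := by
  have hp : p ∈ C.ground := h1.1 (by simp)
  have hq : q ∈ C.ground := h1.1 (by simp)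
  have hr : r ∈ C.ground := h2.1 (by simp)
  have hX : ({p, q, r} : Finset α) ⊆ C.ground := by
    simp [Finset.insert_subset_iff, hp, hq, hr]
  have hmeet : ∀ {x y}, C.IsCover {x, y} → ∀ A ∈ C.members, x ∈ A ∨ y ∈ A := by
    intro x y hxy A hA
    obtain ⟨v, hv⟩ := hxy.2 A hA
    simp only [Finset.mem_inter, Finset.mem_insert, Finset.mem_singleton] at hv
    rcases hv with ⟨hv, rfl | rfl⟩
    · exact Or.inl hv
    · exact Or.inr hv
  have havoid : ∀ x ∈ C.ground, ∃ A ∈ C.members, x ∉ A := by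
    intro x hx
    by_contra! hno
    have := h.two_le_card (B := {x}) ⟨by simpa using hx, fun A hA => ⟨x, by simp [hno A hA]⟩⟩
    simp at this
  have hmem : (C.contractTo {p, q, r}).members = {{q, r}, {p, q}, {p, r}} := by
    have f1 : ∃ A ∈ C.members, A ∩ {p, q, r} = {q, r} := by
      obtain ⟨A, hA, hxA⟩ := havoid p hp
      refine ⟨A, hA, ?_⟩
      have := hmeet h1 A hA
      have := hmeet h2 A hA
      grind
    have f2 : ∃ A ∈ C.members, A ∩ {p, q, r} = {p, q} := by
      obtain ⟨A, hA, hxA⟩ := havoid r hr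
      refine ⟨A, hA, ?_⟩
      have := hmeet h2 A hA
      have := hmeet h3 A hA
      grind
    have f3 : ∃ A ∈ C.members, A ∩ {p, q, r} = {p, r} := by
      obtain ⟨A, hA, hxA⟩ := havoid q hq
      refine ⟨A, hA, ?_⟩
      have := hmeet h1 A hA
      have := hmeet h3 A hA
      grind
    ext M
    rw [mem_contractTo_members]
    simp only [Finset.mem_insert, Finset.mem_singleton]
    constructor
    · intro hM
      obtain ⟨A, hA, hAM⟩ := hM.prop
      have a1 := hmeet h1 A hA
      have a2 := hmeet h2 A hA
      have a3 := hmeet h3 A hA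
      by_cases hpA : p ∈ A
      · by_cases hqA : q ∈ A
        · right; left
          exact (hM.eq_of_le f2 (by subst hAM; intro v; simp; grind)).symm
        · right; right
          exact (hM.eq_of_le f3 (by subst hAM; intro v; simp; grind)).symm
      · left
        exact (hM.eq_of_le f1 (by subst hAM; intro v; simp; grind)).symm
    · rintro (rfl | rfl | rfl)
      · refine ⟨f1, ?_⟩
        rintro _ ⟨A, hA, rfl⟩ hle
        have a1 := hmeet h1 A hA
        have a2 := hmeet h2 A hA
        intro v hv
        have := @hle p
        grind
      · refine ⟨f2, ?_⟩
        rintro _ ⟨A, hA, rfl⟩ hle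
        have a1 := hmeet h2 A hA
        have a2 := hmeet h3 A hA
        intro v hv
        have := @hle r
        grind
      · refine ⟨f3, ?_⟩
        rintro _ ⟨A, hA, rfl⟩ hle
        have a1 := hmeet h1 A hA
        have a2 := hmeet h3 A hA
        intro v hv
        have := @hle q
        grind
  have herase : ({p, q, r} : Finset α).erase p = {q, r} := by
    ext v
    simp only [Finset.mem_erase, Finset.mem_insert, Finset.mem_singleton]
    grind
  refine ⟨?_, p, ?_, ?_⟩
  · rw [contractTo_ground hX, Finset.card_eq_three.2 ⟨p, q, r, hpq, hpr, hqr, rfl⟩]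
  · simp [contractTo_ground hX]
  · rw [contractTo_ground hX, herase, hmem]
    simp [Finset.image_insert]

/-- Covers of the contraction are the covers of `C` inside the cycle. They have at least two
elements, and those with exactly two are the edges of the cycle because it has no chord. -/
theorem IsTangled.isExtendedOddHole_blocker_contractTo (h : C.IsTangled) {n : ℕ} (hn : 5 ≤ n)
    (hodd : Odd n) [NeZero n] {a : ZMod n → α} (ha : Function.Injective a)
    (hcov : ∀ i, C.IsCover {a i, a (i + 1)})
    (hind : ∀ i j, C.IsCover {a i, a j} → i ≠ j → j = i + 1 ∨ i = j + 1) :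
    (C.contractTo (Finset.univ.image a)).blocker.IsExtendedOddHole := by
  have hX : Finset.univ.image a ⊆ C.ground := by
    intro v hv
    obtain ⟨i, -, rfl⟩ := Finset.mem_image.1 hv
    exact (hcov i).1 (by simp)
  have hne : ∀ i : ZMod n, a i ≠ a (i + 1) := by
    intro i hi
    have : (1 : ZMod n) = 0 := by
      have := ha hi
      exact left_eq_add.1 this
    have : n ∣ 1 := by
      rw [← ZMod.natCast_eq_zero_iff]
      exact_mod_cast this
    have := Nat.le_of_dvd one_pos this
    omega
  have hmem : ∀ i, ({a i, a (i + 1)} : Finset α) ∈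
      (C.contractTo (Finset.univ.image a)).blocker.members := by
    intro i
    refine mem_blocker.2 ⟨(contractTo_isCover hX).2 ⟨?_, hcov i⟩, fun B hB hle => ?_⟩
    · intro v hv
      simp only [Finset.mem_insert, Finset.mem_singleton] at hv
      rcases hv with rfl | rfl <;> simp
    · have := h.two_le_card ((contractTo_isCover hX).1 hB).2
      exact (Finset.eq_of_subset_of_card_le hle (by rwa [Finset.card_pair (hne i)])).ge
  refine ⟨n, hn, hodd, a, ha, fun v => ?_, fun A => ⟨?_, ?_⟩⟩
  · show v ∈ (C.contractTo _).ground ↔ _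
    rw [contractTo_ground hX]
    simp
  · rintro ⟨hA, hmin⟩
    obtain ⟨hAX, hAc⟩ := (contractTo_isCover hX).1 (mem_blocker.1 hA).prop
    have h1 := hmin _ (hmem 0)
    rw [Finset.card_pair (hne 0)] at h1
    obtain ⟨u, v, huv, rfl⟩ := Finset.card_eq_two.1 (h1.antisymm (h.two_le_card hAc))
    obtain ⟨i, -, rfl⟩ := Finset.mem_image.1 (hAX (by simp : u ∈ _))
    obtain ⟨j, -, rfl⟩ := Finset.mem_image.1 (hAX (by simp : v ∈ _))
    rcases hind i j hAc (fun hij => huv (by rw [hij])) with rfl | rfl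
    · exact ⟨i, rfl⟩
    · exact ⟨j, Finset.pair_comm _ _⟩
  · rintro ⟨i, rfl⟩
    refine ⟨hmem i, fun B hB => ?_⟩
    rw [Finset.card_pair (hne i)]
    exact h.two_le_card ((contractTo_isCover hX).1 (mem_blocker.1 hB).prop).2

/-- The graph of minimum covers of a clean tangled clutter is bipartite. -/
theorem IsTangled.exists_two_coloring (h : C.IsTangled) (hC : C.IsClean) :
    ∃ c : {v // v ∈ C.ground} → Bool, ∀ u v, C.coverGraph.Adj u v → c u ≠ c v := by
  refine SimpleGraph.exists_two_coloring fun u p hp => ?_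
  obtain ⟨n, hodd, hn, a, hadj, h0, hinj, hind⟩ := SimpleGraph.exists_induced_odd_cycle p hp
  have hn3 : n = 3 ∨ 5 ≤ n := by
    obtain ⟨k, hk⟩ := hodd
    omega
  rcases hn3 with rfl | hn5
  · have h01 := hadj 0 (by omega)
    have h12 := hadj 1 (by omega)
    have h20 := hadj 2 (by omega)
    norm_num at h01 h12 h20
    rw [h0] at h20
    refine (hC _ (contractTo_isMinorOf _)).1 (h.isDelta_contractTo (p := a 0) (q := a 1) (r := a 2)
      ?_ ?_ ?_ h01.2.1 h20.symm.2.1 h12.2.1)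
    · exact fun e => h01.1 (Subtype.ext e)
    · exact fun e => h20.1 (Subtype.ext e.symm)
    · exact fun e => h12.1 (Subtype.ext e)
  · have : NeZero n := ⟨by omega⟩
    have hsucc : ∀ i : ZMod n, a (i + 1).val = a (i.val + 1) := by
      intro i
      rcases lt_or_eq_of_le (Nat.succ_le_of_lt i.val_lt) with hlt | heq
      · have : Fact (1 < n) := ⟨by omega⟩
        rw [ZMod.val_add_of_lt (by rw [ZMod.val_one]; omega), ZMod.val_one]
      · have : i + 1 = 0 := by
          rw [← ZMod.natCast_zmod_val i, ← Nat.cast_one (R := ZMod n), ← Nat.cast_add]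
          exact (ZMod.natCast_eq_zero_iff _ _).2 (dvd_of_eq heq.symm)
        rw [this, ZMod.val_zero, ← h0]
        exact congrArg a heq.symm
    have hval : ∀ i j : ZMod n, i.val < j.val → C.coverGraph.Adj (a i.val) (a j.val) →
        j = i + 1 ∨ i = j + 1 := by
      intro i j hij hGij
      rcases hind _ _ hij j.val_lt hGij with e | ⟨e1, e2⟩
      · left
        rw [← ZMod.natCast_zmod_val j, e, Nat.cast_add, ZMod.natCast_zmod_val, Nat.cast_one]
      · right
        rw [(ZMod.val_eq_zero i).1 e1, ← ZMod.natCast_zmod_val j, e2, ← Nat.cast_one (R := ZMod n),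
          ← Nat.cast_add, Nat.sub_add_cancel (by omega), ZMod.natCast_self]
    have hinj' : Function.Injective fun i : ZMod n => (a i.val : α) := by
      intro i j hij
      have hij : a i.val = a j.val := Subtype.ext hij
      refine ZMod.val_injective n ?_
      rcases lt_trichotomy i.val j.val with hlt | heq | hlt
      · exact absurd hij (hinj _ _ hlt j.val_lt)
      · exact heq
      · exact absurd hij.symm (hinj _ _ hlt i.val_lt)
    refine (hC _ (contractTo_isMinorOf _)).2 ⟨_, h.isExtendedOddHole_blocker_contractTo hn5 hodd
      hinj' (fun i => ?_) (fun i j hc hij => ?_), (blocker_blocker _).symm⟩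
    · have := hadj i.val i.val_lt
      rw [← hsucc] at this
      exact this.2.1
    · have hne : (a i.val : α) ≠ a j.val := fun e => hij (hinj' e)
      have hGij : C.coverGraph.Adj (a i.val) (a j.val) :=
        ⟨fun e => hne (congrArg Subtype.val e),
          h.isMinimumCover_iff.2 ⟨hc, Finset.card_pair hne⟩⟩
      rcases lt_trichotomy i.val j.val with hlt | heq | hlt
      · exact hval i j hlt hGij
      · exact absurd (ZMod.val_injective n heq) hij
      · exact (hval j i hlt hGij.symm).symm

end Clutter

/-! ### Setcores: existence, and separation of components. -/

namespace Clutter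

variable {α : Type*} [DecidableEq α] {C : Clutter α}

theorem mem_cuboid_member {n : ℕ} (p : Fin n → Bool) (x : Fin n × Bool) :
    x ∈ Finset.univ.image (fun i => (i, p i)) ↔ p x.1 = x.2 := by
  simp only [Finset.mem_image, Finset.mem_univ, true_and]
  constructor
  · rintro ⟨i, rfl⟩
    rfl
  · exact fun h => ⟨x.1, Prod.ext rfl h⟩

/-- A clutter is a duplication of a cuboid via `f` if `f` is onto and the members are the sets
`{v | p (f v).1 = (f v).2}`. -/
theorem isDuplicationOf_cuboid_iff {D : Clutter α} {n : ℕ} {S : Finset (Fin n → Bool)} :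
    D.IsDuplicationOf (cuboid S) ↔ ∃ f : α → Fin n × Bool,
      (∀ x, ∃ v ∈ D.ground, f v = x) ∧
        D.members = S.image fun p => D.ground.filter fun v => p (f v).1 = (f v).2 := by
  have h : ∀ f : α → Fin n × Bool,
      (cuboid S).members.image (fun A => D.ground.filter (fun v => f v ∈ A)) =
        S.image fun p => D.ground.filter fun v => p (f v).1 = (f v).2 := by
    intro f
    simp only [cuboid, Finset.image_image]
    refine Finset.image_congr fun p _ => ?_
    simp only [Function.comp_apply, mem_cuboid_member]
  unfold IsDuplicationOf
  simp only [h]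
  refine exists_congr fun f => and_congr_left fun _ => ?_
  simp [cuboid, Finset.eq_univ_iff_forall]

theorem IsTangled.exists_adj (h : C.IsTangled) (u : {v // v ∈ C.ground}) :
    ∃ v, C.coverGraph.Adj u v := by
  obtain ⟨B, hB, huB⟩ := h.2 u u.2
  obtain ⟨v, hvB, hvu⟩ := Finset.exists_mem_ne
    (by rw [(h.isMinimumCover_iff.1 hB).2]; norm_num) (u : α)
  refine ⟨⟨v, hB.1.1 hvB⟩, fun e => hvu (congrArg Subtype.val e).symm, ?_⟩
  have : ({u.1, v} : Finset α) = B := by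
    refine Finset.eq_of_subset_of_card_le ?_ ?_
    · simp [Finset.insert_subset_iff, huB, hvB]
    · rw [(h.isMinimumCover_iff.1 hB).2, Finset.card_pair hvu.symm]
  simpa [this] using hB

theorem IsTransversal.mem_iff_notMem {A : Finset α} (hA : C.IsTransversal A)
    {u v : {v // v ∈ C.ground}} (huv : C.coverGraph.Adj u v) : u.1 ∈ A ↔ v.1 ∉ A := by
  have hne : u.1 ≠ v.1 := fun e => huv.1 (Subtype.ext e)
  have h1 := hA.2 _ huv.2
  by_cases hu : u.1 ∈ A <;> by_cases hv : v.1 ∈ A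
  · rw [Finset.inter_eq_right.2 (by simp [Finset.insert_subset_iff, hu, hv]),
      Finset.card_pair hne] at h1
    omega
  · simp [hu, hv]
  · simp [hu, hv]
  · rw [Finset.card_eq_one] at h1
    obtain ⟨a, ha⟩ := h1
    have := Finset.mem_inter.1 (ha ▸ Finset.mem_singleton_self a : a ∈ A ∩ {u.1, v.1})
    grind

theorem _root_.SimpleGraph.Reachable.apply_eq {V β : Type*} {G : SimpleGraph V} {φ : V → β}
    (hφ : ∀ u v, G.Adj u v → φ u = φ v) {u v : V} (h : G.Reachable u v) : φ u = φ v := by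
  obtain ⟨p⟩ := h
  induction p with
  | nil => rfl
  | cons hadj _ ih => exact (hφ _ _ hadj).trans ih

/-- Crossing an edge flips both membership in `A` and the colour. -/
theorem IsTransversal.xor_eq_of_reachable {A : Finset α} (hA : C.IsTransversal A)
    {c : {v // v ∈ C.ground} → Bool} (hc : ∀ u v, C.coverGraph.Adj u v → c u ≠ c v)
    {u v : {v // v ∈ C.ground}} (huv : C.coverGraph.Reachable u v) :
    xor (decide (u.1 ∈ A)) (c u) = xor (decide (v.1 ∈ A)) (c v) := by
  refine huv.apply_eq (φ := fun u => xor (decide (u.1 ∈ A)) (c u)) fun u v huv => ?_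
  have h1 := hA.mem_iff_notMem huv
  have h2 := hc u v huv
  by_cases hv : v.1 ∈ A <;> cases hcu : c u <;> cases hcv : c v <;> simp_all

theorem IsTangled.exists_isSetcore (h : C.IsTangled) (hC : C.IsClean) :
    ∃ S : Finset (Fin C.rank → Bool), C.IsSetcore S := by
  classical
  obtain ⟨c, hc⟩ := h.exists_two_coloring hC
  let e : C.coverGraph.ConnectedComponent ≃ Fin C.rank := Finite.equivFin _
  obtain ⟨v0, hv0⟩ := h.ground_nonempty
  let g : {v // v ∈ C.ground} → Fin C.rank × Bool :=
    fun v => (e (C.coverGraph.connectedComponentMk v), c v)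
  -- The value outside the ground set is arbitrary; duplication only looks at the ground set.
  let f : α → Fin C.rank × Bool := fun v => if hv : v ∈ C.ground then g ⟨v, hv⟩ else g ⟨v0, hv0⟩
  have hf : ∀ v : {v // v ∈ C.ground}, f v = g v := fun v => dif_pos v.2
  refine ⟨Finset.univ.filter fun p => ∃ A ∈ C.core.members,
    A = C.ground.filter fun v => p (f v).1 = (f v).2, ?_⟩
  refine isDuplicationOf_cuboid_iff.2 ⟨f, ?_, ?_⟩
  · rintro ⟨i, b⟩
    obtain ⟨u, hu⟩ : ∃ u, C.coverGraph.connectedComponentMk u = e.symm i :=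
      (e.symm i).exists_rep
    obtain ⟨v, huv⟩ := h.exists_adj u
    by_cases hb : c u = b
    · refine ⟨u, u.2, ?_⟩
      rw [hf]
      simp [g, hu, hb]
    · refine ⟨v, v.2, ?_⟩
      rw [hf]
      have hcv : c v = b := by
        have := hc u v huv
        cases hcu : c u <;> cases hcv : c v <;> cases b <;> simp_all
      simp [g, ← SimpleGraph.ConnectedComponent.sound huv.reachable, hu, hcv]
  · ext A
    simp only [Finset.mem_image, Finset.mem_filter, Finset.mem_univ, true_and]
    constructor
    · intro hA
      have hAT := h.isTransversal_of_mem_core hA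
      -- Coordinate i is the colour of the class of component i that `A` contains, read off at a
      -- representative.
      refine ⟨fun i => !(xor (decide ((e.symm i).out.1 ∈ A)) (c (e.symm i).out)), ?_⟩
      have key : A = C.ground.filter fun v =>
          (!(xor (decide ((e.symm (f v).1).out.1 ∈ A)) (c (e.symm (f v).1).out))) = (f v).2 := by
        ext v
        rw [Finset.mem_filter]
        by_cases hv : v ∈ C.ground
        · have hfv := hf ⟨v, hv⟩
          have hr : C.coverGraph.Reachable (e.symm (f v).1).out ⟨v, hv⟩ := by
            rw [hfv]
            simp only [g, Equiv.symm_apply_apply]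
            exact SimpleGraph.ConnectedComponent.exact (Quot.out_eq _)
          rw [hAT.xor_eq_of_reachable hc hr, hfv]
          by_cases hvA : v ∈ A <;> simp [hv, hvA, g]
        · simp only [hv, false_and, iff_false]
          exact fun hvA => hv (C.subset_ground A hAT.1 hvA)
      exact ⟨⟨A, hA, key⟩, key.symm⟩
    · rintro ⟨p, ⟨A', hA', rfl⟩, rfl⟩
      exact hA'

/-- In an ideal tangled clutter with bipartite graph of minimum covers, elements of different
components are told apart by the members of the core, even up to complementation. -/
theorem IsTangled.exists_core_separating (h : C.IsTangled) (hI : C.IsIdeal)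
    {c : {v // v ∈ C.ground} → Bool} (hc : ∀ u v, C.coverGraph.Adj u v → c u ≠ c v)
    {u v : {v // v ∈ C.ground}} (huv : ¬ C.coverGraph.Reachable u v) :
    (∃ A ∈ C.core.members, ¬ (u.1 ∈ A ↔ v.1 ∈ A)) ∧ ∃ A ∈ C.core.members, (u.1 ∈ A ↔ v.1 ∈ A) := by
  classical
  have key : ∀ v : {v // v ∈ C.ground}, ¬ C.coverGraph.Reachable u v →
      ∃ A ∈ C.core.members, ¬ (u.1 ∈ A ↔ v.1 ∈ A) := by
    intro v huv
    by_contra! hcon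
    -- The signed colouring of the component of `u` sums to zero on every minimum cover, is ±1 at
    -- `u` and 0 at `v`.
    let g : α → ℝ := fun w => if hw : w ∈ C.ground then
      if C.coverGraph.Reachable u ⟨w, hw⟩ then (if c ⟨w, hw⟩ then 1 else -1) else 0 else 0
    have hg : ∀ w : {v // v ∈ C.ground}, g w =
        if C.coverGraph.Reachable u w then (if c w then 1 else -1) else 0 := fun w => dif_pos w.2
    have := h.eq_of_mem_transversal_iff hI u.2 v.2
      (fun A hA => hcon A ((h.mem_core_iff_isTransversal hI).2 hA)) (g := g) (by
        intro B hB
        obtain ⟨hBc, hB2⟩ := h.isMinimumCover_iff.1 hB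
        obtain ⟨x, y, hxy, rfl⟩ := Finset.card_eq_two.1 hB2
        have hx : x ∈ C.ground := hBc.1 (by simp)
        have hy : y ∈ C.ground := hBc.1 (by simp)
        have hadj : C.coverGraph.Adj ⟨x, hx⟩ ⟨y, hy⟩ :=
          ⟨fun e => hxy (congrArg Subtype.val e), hB⟩
        have hiff : C.coverGraph.Reachable u ⟨x, hx⟩ ↔ C.coverGraph.Reachable u ⟨y, hy⟩ :=
          ⟨fun r => r.trans hadj.reachable, fun r => r.trans hadj.reachable.symm⟩
        have hcne := hc _ _ hadj
        rw [Finset.sum_pair hxy, hg ⟨x, hx⟩, hg ⟨y, hy⟩]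
        simp only [hiff]
        split_ifs <;> simp_all)
    rw [hg, hg, if_neg huv, if_pos (SimpleGraph.Reachable.refl u)] at this
    split_ifs at this <;> norm_num at this
  refine ⟨key v huv, ?_⟩
  -- A neighbour `w` of `v` is in a transversal member exactly when `v` is not, so separating `u`
  -- from `w` means agreement of `u` and `v`.
  obtain ⟨w, hvw⟩ := h.exists_adj v
  obtain ⟨A, hA, hne⟩ := key w fun r => huv (r.trans hvw.reachable.symm)
  refine ⟨A, hA, ?_⟩
  have := (h.isTransversal_of_mem_core hA).mem_iff_notMem hvw
  tauto

end Clutter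

/-! ### Simplices with 0-1 vertices. -/

/-- The real point with the coordinates of a `0-1` point. -/
def cubePoint {n : ℕ} (p : Fin n → Bool) : Fin n → ℝ := fun i => if p i then 1 else 0

theorem cubePoint_injective {n : ℕ} : Function.Injective (cubePoint (n := n)) := by
  intro p q hpq
  funext i
  have := congrFun hpq i
  unfold cubePoint at this
  cases hp : p i <;> cases hq : q i <;> simp_all

theorem cubePoint_mem_extremePoints {n : ℕ} {S : Finset (Fin n → Bool)} {p : Fin n → Bool}
    (hp : p ∈ S) : cubePoint p ∈ Set.extremePoints ℝ (cubeConvexHull S) := by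
  have hsub : cubeConvexHull S ⊆ Set.Icc 0 1 := by
    refine convexHull_min ?_ (convex_Icc _ _)
    rintro _ ⟨q, -, rfl⟩
    constructor <;> intro i <;> by_cases h : q i <;> simp [h]
  refine mem_extremePoints.2 ⟨subset_convexHull ℝ _ ⟨p, hp, rfl⟩, fun y hy z hz hseg => ?_⟩
  obtain ⟨a, b, ha, hb, hab, heq⟩ := hseg
  have hcoord : ∀ i, y i = cubePoint p i ∧ z i = cubePoint p i := by
    intro i
    have h1 : a * y i + b * z i = cubePoint p i := congrFun heq i
    have y0 : 0 ≤ y i := (hsub hy).1 i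
    have y1 : y i ≤ 1 := (hsub hy).2 i
    have z0 : 0 ≤ z i := (hsub hz).1 i
    have z1 : z i ≤ 1 := (hsub hz).2 i
    have e1 := mul_nonneg ha.le y0
    have e2 := mul_nonneg hb.le z0
    have e3 := mul_nonneg ha.le (sub_nonneg.2 y1)
    have e4 := mul_nonneg hb.le (sub_nonneg.2 z1)
    unfold cubePoint at h1 ⊢
    split_ifs at h1 ⊢
    · have f1 : a * (1 - y i) = 0 := by linarith
      have f2 : b * (1 - z i) = 0 := by linarith
      constructor
      · linarith [(mul_eq_zero.1 f1).resolve_left ha.ne']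
      · linarith [(mul_eq_zero.1 f2).resolve_left hb.ne']
    · have f1 : a * y i = 0 := by linarith
      have f2 : b * z i = 0 := by linarith
      exact ⟨(mul_eq_zero.1 f1).resolve_left ha.ne', (mul_eq_zero.1 f2).resolve_left hb.ne'⟩
  exact ⟨funext fun i => (hcoord i).1, funext fun i => (hcoord i).2⟩

/-- Points of `S` are extreme in the hull, hence vertices of the simplex, hence affinely
independent; the extra coordinate 1 turns this into linear independence. -/
theorem IsSimplexSet.linearIndependent {n : ℕ} {S : Finset (Fin n → Bool)}
    (h : IsSimplexSet (cubeConvexHull S)) :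
    LinearIndependent ℝ fun p : S => ((1 : ℝ), cubePoint p.1) := by
  obtain ⟨m, s, hs⟩ := h
  have hmem : ∀ p : S, ∃ k, s.points k = cubePoint p.1 := by
    intro p
    have := cubePoint_mem_extremePoints p.2
    rw [hs] at this
    exact Set.mem_range.1 (extremePoints_convexHull_subset this)
  choose k hk using hmem
  have hkinj : Function.Injective k := by
    intro p q hpq
    refine Subtype.ext (cubePoint_injective ?_)
    rw [← hk, ← hk, hpq]
  have hind := affineIndependent_iff.1 (s.independent.comp_embedding ⟨k, hkinj⟩)
  refine linearIndependent_iff'.2 fun t w hw => ?_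
  have h1 := congrArg Prod.fst hw
  have h2 := congrArg Prod.snd hw
  rw [Prod.fst_sum] at h1
  rw [Prod.snd_sum] at h2
  refine hind t w (by simpa using h1) ?_
  simpa [hk] using h2

theorem IsSimplexSet.nonempty {n : ℕ} {S : Finset (Fin n → Bool)}
    (h : IsSimplexSet (cubeConvexHull S)) : S.Nonempty := by
  obtain ⟨m, s, hs⟩ := h
  have : (cubeConvexHull S).Nonempty := by
    rw [hs]
    exact (Set.range_nonempty _).convexHull
  simpa [cubeConvexHull] using this

theorem IsSimplexSet.card_le {n : ℕ} {S : Finset (Fin n → Bool)}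
    (h : IsSimplexSet (cubeConvexHull S)) : S.card ≤ n + 1 := by
  have := h.linearIndependent.fintype_card_le_finrank
  simpa [add_comm] using this

/-- If the convex hull of `S` is a simplex, every vertex is cut off by an affine function that
vanishes on the other vertices. -/
theorem IsSimplexSet.exists_affine {n : ℕ} {S : Finset (Fin n → Bool)}
    (h : IsSimplexSet (cubeConvexHull S)) {p : Fin n → Bool} (hp : p ∈ S) :
    ∃ (a : ℝ) (b : Fin n → ℝ), ∀ q ∈ S, a + ∑ i, (if q i then b i else 0) =
      if q = p then 1 else 0 := by
  classical
  have hli := h.linearIndependent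
  -- A left inverse supplies coordinate functionals dual to the lifted points; the one belonging to
  -- `p` is the affine function wanted.
  obtain ⟨g, hg⟩ := LinearMap.exists_leftInverse_of_injective
    (Finsupp.linearCombination ℝ fun p : S => ((1 : ℝ), cubePoint p.1))
    (LinearMap.ker_eq_bot.2 hli)
  let φ : ℝ × (Fin n → ℝ) →ₗ[ℝ] ℝ := Finsupp.lapply ⟨p, hp⟩ ∘ₗ g
  refine ⟨φ (1, 0), fun i => φ (0, Pi.single i 1), fun q hq => ?_⟩
  have h1 : φ (1, cubePoint q) = if q = p then 1 else 0 := by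
    have := LinearMap.congr_fun hg (Finsupp.single ⟨q, hq⟩ 1)
    simp only [LinearMap.comp_apply, Finsupp.linearCombination_single, one_smul,
      LinearMap.id_apply] at this
    simp [φ, this, Finsupp.single_apply]
  rw [← h1]
  have h2 : ((1 : ℝ), cubePoint q) =
      (1, 0) + ∑ i, if q i then ((0 : ℝ), (Pi.single i 1 : Fin n → ℝ)) else 0 := by
    refine Prod.ext ?_ ?_
    · rw [Prod.fst_add, Prod.fst_sum]
      simp [apply_ite Prod.fst]
    · rw [Prod.snd_add, Prod.snd_sum]
      funext j
      have : ∀ i, (if q i then (Pi.single i 1 : Fin n → ℝ) else 0) j =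
          if j = i then (if q i then 1 else 0) else 0 := by
        intro i
        by_cases hq : q i <;> simp [hq, Pi.single_apply]
      simp [apply_ite Prod.snd, cubePoint, Finset.sum_apply, this]
  rw [h2, map_add, map_sum]
  congr 1
  refine Finset.sum_congr rfl fun i _ => ?_
  split_ifs <;> simp

/-! ### The finite classification in the cube. -/

/-- Both sides say that the sum of the four bits is even. -/
theorem Bool.eq_iff_eq_iff_comm {a b c d : Bool} : (a = c ↔ b = d) ↔ (a = b ↔ c = d) := by
  revert a b c d
  decide

/-- The combinatorial core of the classification: positive weights on a set of at most `n + 1`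
points of the `n`-cube, each being at least one or at least one half, such that every facet of the
cube has total weight one. -/
theorem classification_of_weights {n : ℕ} (hn : 0 < n) {S : Finset (Fin n → Bool)}
    {w : (Fin n → Bool) → ℝ} (hpos : ∀ p ∈ S, 0 < w p)
    (hhalf : ∀ p ∈ S, w p < 1 → 1 / 2 ≤ w p)
    (hsum : ∀ i b, ∑ p ∈ S with p i = b, w p = 1)
    (hne : ∀ i j, i ≠ j → (∃ p ∈ S, p i ≠ p j) ∧ ∃ p ∈ S, p i = p j)
    (hcard : S.card ≤ n + 1) :
    (n = 1 ∧ S = {fun _ => false, fun _ => true}) ∨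
      ∃ (p : Fin 3 → Bool) (e : Fin 3 ≃ Fin n), S = Finset.image (fun (q : Fin 3 → Bool) i =>
        xor (q (e.symm i)) (p (e.symm i)))
          {![false, false, false], ![true, true, false], ![true, false, true],
            ![false, true, true]} := by
  classical
  have hex : ∀ i b, ∃ p ∈ S, p i = b := by
    intro i b
    by_contra! hno
    have := hsum i b
    rw [Finset.filter_eq_empty_iff.2 (fun p hp => hno p hp)] at this
    simp at this
  by_cases hone : ∃ p ∈ S, 1 ≤ w p
  · left
    obtain ⟨p, hp, hwp⟩ := hone
    -- The weight of `p` already fills every facet through `p`, so every other point is antipodal.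
    -- Then any two coordinates agree or disagree consistently throughout `S`, which `hne` forbids.
    have hopp : ∀ q ∈ S, q ≠ p → ∀ i, q i ≠ p i := by
      intro q hq hqp i hi
      have h1 : ∑ r ∈ ({p, q} : Finset (Fin n → Bool)), w r ≤ ∑ r ∈ S with r i = p i, w r := by
        refine Finset.sum_le_sum_of_subset_of_nonneg ?_ fun r hr _ =>
          (hpos r (Finset.mem_filter.1 hr).1).le
        intro r hr
        simp only [Finset.mem_insert, Finset.mem_singleton] at hr
        rcases hr with rfl | rfl
        · exact Finset.mem_filter.2 ⟨hp, rfl⟩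
        · exact Finset.mem_filter.2 ⟨hq, hi⟩
      rw [Finset.sum_pair hqp.symm, hsum] at h1
      linarith [hpos q hq]
    have hsub : ∀ i j : Fin n, i = j := by
      intro i j
      by_contra hij
      obtain ⟨⟨q, hq, h1⟩, ⟨r, hr, h2⟩⟩ := hne i j hij
      have key : ∀ s ∈ S, (s i = s j ↔ p i = p j) := by
        intro s hs
        by_cases hsp : s = p
        · rw [hsp]
        · exact Bool.eq_iff_eq_iff_comm.1 (iff_of_false (hopp s hs hsp i) (hopp s hs hsp j))
      exact h1 ((key q hq).2 ((key r hr).1 h2))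
    have hn1 : n = 1 := by
      by_contra h
      have := hsub ⟨0, hn⟩ ⟨1, by omega⟩
      simp at this
    subst hn1
    refine ⟨rfl, ?_⟩
    have hconst : ∀ q : Fin 1 → Bool, q = fun _ => q 0 := fun q => funext fun i => by
      rw [Subsingleton.elim i 0]
    ext q
    simp only [Finset.mem_insert, Finset.mem_singleton]
    constructor
    · intro _
      rw [hconst q]
      cases q 0 <;> simp
    · rintro (rfl | rfl)
      · obtain ⟨q, hq, h0⟩ := hex 0 false
        rwa [hconst q, h0] at hq
      · obtain ⟨q, hq, h0⟩ := hex 0 true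
        rwa [hconst q, h0] at hq
  · right
    push Not at hone
    have hw : ∀ p ∈ S, 1 / 2 ≤ w p := fun p hp => hhalf p hp (hone p hp)
    -- At most two points since each weighs at least 1/2; at least two since a single point weighs
    -- less than 1.
    have htwo : ∀ i b, (S.filter fun p => p i = b).card = 2 := by
      intro i b
      refine le_antisymm ?_ ?_
      · have h1 : ∑ p ∈ S with p i = b, (1 / 2 : ℝ) ≤ ∑ p ∈ S with p i = b, w p :=
          Finset.sum_le_sum fun p hp => hw p (Finset.mem_filter.1 hp).1
        rw [hsum, Finset.sum_const, nsmul_eq_mul] at h1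
        have h2 : ((S.filter fun p => p i = b).card : ℝ) ≤ 2 := by linarith
        exact_mod_cast h2
      · by_contra! hlt
        obtain ⟨p, hp, hpi⟩ := hex i b
        have h1 : (S.filter fun p => p i = b) = {p} := by
          refine (Finset.eq_of_subset_of_card_le
            (Finset.singleton_subset_iff.2 (Finset.mem_filter.2 ⟨hp, hpi⟩)) ?_).symm
          rw [Finset.card_singleton]
          omega
        have h2 := hsum i b
        rw [h1, Finset.sum_singleton] at h2
        exact absurd h2 (hone p hp).ne
    have hcard4 : S.card = 4 := by
      rw [← Finset.card_filter_add_card_filter_not (s := S) (fun p => p ⟨0, hn⟩ = true)]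
      simp only [Bool.not_eq_true, htwo]
    obtain ⟨p, hp, -⟩ := hex ⟨0, hn⟩ true
    have hq : ∀ i, ∃ q ∈ S, q ≠ p ∧ q i = p i ∧ ∀ r ∈ S, r i = p i → r = p ∨ r = q := by
      intro i
      obtain ⟨x, y, hxy, hS⟩ := Finset.card_eq_two.1 (htwo i (p i))
      have hmem : ∀ r, (r ∈ S ∧ r i = p i) ↔ r = x ∨ r = y := by
        intro r
        have : r ∈ S.filter (fun r => r i = p i) ↔ r ∈ ({x, y} : Finset (Fin n → Bool)) := by
          rw [hS]
        simpa using this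
      rcases (hmem p).1 ⟨hp, rfl⟩ with rfl | rfl
      · obtain ⟨hy, hyi⟩ := (hmem y).2 (Or.inr rfl)
        exact ⟨y, hy, hxy.symm, hyi, fun r hr hri => (hmem r).1 ⟨hr, hri⟩⟩
      · obtain ⟨hx, hxi⟩ := (hmem x).2 (Or.inl rfl)
        exact ⟨x, hx, hxy, hxi, fun r hr hri => ((hmem r).1 ⟨hr, hri⟩).symm⟩
    choose q hqS hqp hqi hquniq using hq
    have hagree : ∀ i, ∀ r ∈ S, r i = p i ↔ r = p ∨ r = q i := by
      refine fun i r hr => ⟨hquniq i r hr, ?_⟩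
      rintro (rfl | rfl)
      · rfl
      · exact hqi i
    -- If `q i = q j`, the same points agree with `p` at i as at j, so the two coordinates are not
    -- separated.
    have hqinj : Function.Injective q := by
      intro i j hij
      by_contra hne'
      obtain ⟨⟨r, hr, h1⟩, ⟨s, hs, h2⟩⟩ := hne i j hne'
      have key : ∀ s ∈ S, (s i = s j ↔ p i = p j) := by
        intro s hs
        refine Bool.eq_iff_eq_iff_comm.1 ?_
        rw [hagree i s hs, hagree j s hs, hij]
      exact h1 ((key r hr).2 ((key s hs).1 h2))
    have himage : Finset.univ.image q ⊆ S.erase p := by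
      intro r hr
      obtain ⟨i, -, rfl⟩ := Finset.mem_image.1 hr
      exact Finset.mem_erase.2 ⟨hqp i, hqS i⟩
    have hcardq : (Finset.univ.image q).card = n := by
      rw [Finset.card_image_of_injective _ hqinj, Finset.card_univ, Fintype.card_fin]
    have hcarde : (S.erase p).card = 3 := by rw [Finset.card_erase_of_mem hp, hcard4]
    -- At most 3 because the `q i` are distinct points of `S` other than `p`; at least 3 because 4 =
    -- |S| ≤ n + 1.
    have hn3 : n = 3 := by
      have := Finset.card_le_card himage
      omega
    subst hn3
    have hSeq : S = insert p (Finset.univ.image q) := by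
      rw [Finset.eq_of_subset_of_card_le himage (by omega), Finset.insert_erase hp]
    have hqval : ∀ i j, q i j = xor (decide (j ≠ i)) (p j) := by
      intro i j
      by_cases hij : j = i
      · subst hij
        simp [hqi]
      · have : q i j ≠ p j := fun h => (((hagree j _ (hqS i)).1 h).elim (hqp i)
          fun h => hij (hqinj h).symm)
        cases h1 : q i j <;> cases h2 : p j <;> simp_all
    refine ⟨p, Equiv.refl _, ?_⟩
    have hq' : ∀ i, q i = fun j => xor (decide (j ≠ i)) (p j) := fun i => funext (hqval i)
    -- The order 2, 1, 0 lists `p`, `q 2`, `q 1`, `q 0`, which are the twists by `p` of 000, 110,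
    -- 101, 011 in the order of the statement.
    have huniv : (Finset.univ : Finset (Fin 3)) = {2, 1, 0} := by decide
    rw [hSeq, huniv]
    simp only [Finset.image_insert, Finset.image_singleton, hq', Equiv.refl_symm, Equiv.refl_apply]
    congr 1
    · funext i
      fin_cases i <;> simp
    congr 1
    · funext i
      fin_cases i <;> simp
    congr 1
    · funext i
      fin_cases i <;> simp
    congr 1
    · funext i
      fin_cases i <;> simp

/-! ### Applying the classification to setcores. -/

namespace Clutter

theorem IsDuplicationOf.trans {α β γ : Type*} [DecidableEq α] [DecidableEq β] [DecidableEq γ]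
    {D : Clutter α} {E : Clutter β} {F : Clutter γ} (h1 : D.IsDuplicationOf E)
    (h2 : E.IsDuplicationOf F) : D.IsDuplicationOf F := by
  obtain ⟨f, hf, hfm⟩ := h1
  obtain ⟨g, hg, hgm⟩ := h2
  refine ⟨g ∘ f, by rw [← Finset.image_image, hf, hg], ?_⟩
  rw [hfm, hgm, Finset.image_image]
  refine Finset.image_congr fun A _ => ?_
  ext v
  simp only [Function.comp_apply, Finset.mem_filter, and_congr_right_iff, and_iff_right_iff_imp]
  exact fun hv _ => hf ▸ Finset.mem_image_of_mem f hv

theorem cuboid_isDuplicationOf_of_cubeSetIso {n m : ℕ} {S : Finset (Fin n → Bool)}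
    {T : Finset (Fin m → Bool)} (h : CubeSetIso S T) :
    (cuboid S).IsDuplicationOf (cuboid T) := by
  obtain ⟨e, q, rfl⟩ := h
  refine isDuplicationOf_cuboid_iff.2
    ⟨fun x => (e.symm x.1, xor x.2 (q (e.symm x.1))), fun x => ?_, ?_⟩
  · refine ⟨(e x.1, xor x.2 (q x.1)), Finset.mem_univ _, ?_⟩
    simp
  · rw [Finset.image_image]
    refine Finset.image_congr fun p _ => ?_
    ext x
    rw [mem_cuboid_member]
    simp [cuboid]

theorem cuboid_isDuplicationOf_Q6 :
    (cuboid ({![false, false, false], ![true, true, false], ![true, false, true],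
      ![false, true, true]} : Finset (Fin 3 → Bool))).IsDuplicationOf Q6 := by
  refine ⟨fun x => 2 * x.1.val + if x.2 then 1 else 2, ?_, ?_⟩
  · decide
  · decide

variable {α : Type*} [DecidableEq α] {C : Clutter α}

theorem rank_pos (h : C.ground.Nonempty) : 0 < C.rank := by
  obtain ⟨v, hv⟩ := h
  have : Nonempty C.coverGraph.ConnectedComponent := ⟨C.coverGraph.connectedComponentMk ⟨v, hv⟩⟩
  exact Nat.card_pos

theorem IsTangled.setcore_classification (h : C.IsTangled) (hC : C.IsClean) (hI : C.IsIdeal)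
    {S : Finset (Fin C.rank → Bool)} (hS : C.IsSetcore S)
    (hsimplex : IsSimplexSet (cubeConvexHull S)) :
    (C.rank = 1 ∧ S = {fun _ => false, fun _ => true}) ∨
      CubeSetIso S ({![false, false, false], ![true, true, false], ![true, false, true],
          ![false, true, true]} : Finset (Fin 3 → Bool)) := by
  classical
  obtain ⟨c, hc⟩ := h.exists_two_coloring hC
  obtain ⟨f, hf, hmem⟩ := isDuplicationOf_cuboid_iff.1 hS
  have hf : ∀ x, ∃ v ∈ C.ground, f v = x := hf
  set M : (Fin C.rank → Bool) → Finset α := fun p => C.ground.filter fun v => p (f v).1 = (f v).2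
    with hM
  have hmem : C.core.members = S.image M := hmem
  have hMS : ∀ p ∈ S, M p ∈ C.core.members := fun p hp => hmem ▸ Finset.mem_image_of_mem M hp
  have hMinj : Function.Injective M := by
    intro p q hpq
    funext i
    obtain ⟨v, hv, hvi⟩ := hf (i, true)
    have : v ∈ M p ↔ v ∈ M q := by rw [hpq]
    simp only [hM, Finset.mem_filter, hv, hvi, true_and] at this
    exact Bool.eq_iff_iff.2 this
  obtain ⟨y, hy, hy2, hysupp⟩ := exists_packing_pos_iff_mem_core (C := C) (by
    rw [hmem]
    exact hsimplex.nonempty.image M)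
  have hload := (h.load_eq_one hy hy2).2
  have hcore_sub : C.core.members ⊆ C.members := fun A hA => (mem_core.1 hA).1
  have hrank := rank_pos h.ground_nonempty
  have hsum : ∀ i b, ∑ p ∈ S with p i = b, y (M p) = 1 := by
    intro i b
    obtain ⟨v, hv, hvi⟩ := hf (i, b)
    rw [← hload v hv, Finset.sum_filter, Finset.sum_filter, ← Finset.sum_subset hcore_sub, hmem,
      Finset.sum_image hMinj.injOn]
    · refine Finset.sum_congr rfl fun p _ => ?_
      simp [hM, hv, hvi]
    · intro A hA hAc
      have : y A = 0 := le_antisymm (not_lt.1 fun hp => hAc ((hysupp A hA).1 hp)) (hy.1 A hA)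
      simp [this]
  have hhalf : ∀ p ∈ S, y (M p) < 1 → 1 / 2 ≤ y (M p) := by
    intro p hp hlt
    obtain ⟨a, b, hab⟩ := hsimplex.exists_affine hp
    choose u hu hui using fun i => hf (i, true)
    obtain ⟨E, hE⟩ := h.minimumCovers_nonempty
    have hE := mem_minimumCovers.1 hE
    -- Transport of the affine function to the ground set: each core member meets `E` once and so
    -- collects the constant `a`, and `u i` lies in `M q` exactly when `q i` is 1.
    let d : α → ℝ := fun v => (if v ∈ E then a else 0) + ∑ i, if v = u i then b i else 0
    refine h.half_le_of_separated hI hy hy2 hysupp (hMS p hp) hlt (d := d) fun D hD => ?_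
    obtain ⟨q, hq, rfl⟩ := Finset.mem_image.1 (hmem ▸ hD)
    have h1 : ∑ v ∈ M q, (if v ∈ E then a else 0) = a := by
      have := (h.isTransversal_of_mem_core hD).2 E hE
      rw [Finset.sum_ite_mem, Finset.sum_const, this, one_smul]
    have h2 : ∑ v ∈ M q, ∑ i, (if v = u i then b i else 0) = ∑ i, if q i then b i else 0 := by
      rw [Finset.sum_comm]
      refine Finset.sum_congr rfl fun i _ => ?_
      rw [Finset.sum_ite_eq']
      simp [hM, hu, hui]
    rw [Finset.sum_add_distrib, h1, h2, hab q hq]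
    simp [hMinj.eq_iff]
  have hsep : ∀ {u v : {v // v ∈ C.ground}}, ¬ C.coverGraph.Reachable u v →
      (∃ p ∈ S, p (f u).1 ≠ p (f v).1) ∧ ∃ p ∈ S, p (f u).1 = p (f v).1 := by
    intro u v huv
    obtain ⟨⟨A, hA, h1⟩, ⟨B, hB, h2⟩⟩ := h.exists_core_separating hI hc huv
    obtain ⟨p, hp, rfl⟩ := Finset.mem_image.1 (hmem ▸ hA)
    obtain ⟨q, hq, rfl⟩ := Finset.mem_image.1 (hmem ▸ hB)
    simp only [hM, Finset.mem_filter, u.2, v.2, true_and] at h1 h2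
    rw [Bool.eq_iff_eq_iff_comm] at h1 h2
    by_cases hb : (f u).2 = (f v).2
    · exact ⟨⟨p, hp, fun e => h1 (iff_of_true e hb)⟩, ⟨q, hq, h2.2 hb⟩⟩
    · exact ⟨⟨q, hq, fun e => hb (h2.1 e)⟩,
        ⟨p, hp, by_contra fun e => h1 (iff_of_false e hb)⟩⟩
  have hout : ∀ K L : C.coverGraph.ConnectedComponent, K ≠ L →
      ¬ C.coverGraph.Reachable K.out L.out := by
    intro K L hKL hr
    have := SimpleGraph.ConnectedComponent.sound hr
    exact hKL (((Quot.out_eq K).symm.trans this).trans (Quot.out_eq L))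
  -- The setcore is arbitrary, so its coordinates need not be labelled by components. Separation
  -- makes this map injective, and it is bijective because the rank counts the components; `hsep`
  -- thereby reaches all pairs of coordinates.
  let Φ : C.coverGraph.ConnectedComponent → Fin C.rank := fun K => (f K.out.1).1
  have hΦinj : Function.Injective Φ := by
    intro K L hKL
    by_contra hne
    obtain ⟨p, -, hp⟩ := (hsep (hout K L hne)).1
    exact hp (congrArg p hKL)
  have hΦsurj : Function.Surjective Φ :=
    ((Function.Injective.bijective_of_nat_card_le hΦinj (by simp [rank])).2)
  have hne : ∀ i j, i ≠ j → (∃ p ∈ S, p i ≠ p j) ∧ ∃ p ∈ S, p i = p j := by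
    intro i j hij
    obtain ⟨K, rfl⟩ := hΦsurj i
    obtain ⟨L, rfl⟩ := hΦsurj j
    exact hsep (hout K L fun e => hij (by rw [e]))
  rcases classification_of_weights hrank (w := fun p => y (M p))
    (fun p hp => (hysupp _ (hcore_sub (hMS p hp))).2 (hMS p hp)) hhalf hsum hne
    hsimplex.card_le with h1 | ⟨q, e, hSe⟩
  · exact Or.inl h1
  · refine Or.inr ⟨e, q, ?_⟩
    rw [hSe, Finset.image_image]
    simp [Function.comp_def]

theorem isSetcore_partition (h : C.ground.Nonempty) {S : Finset (Fin C.rank → Bool)}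
    (hS : C.IsSetcore S) (hS' : S = {fun _ => false, fun _ => true}) :
    ∃ U W : Finset α, Disjoint U W ∧ U ∪ W = C.ground ∧ U.Nonempty ∧ W.Nonempty ∧
      C.core.members = {U, W} := by
  obtain ⟨f, hf, hmem⟩ := isDuplicationOf_cuboid_iff.1 hS
  subst hS'
  rw [Finset.image_insert, Finset.image_singleton] at hmem
  obtain ⟨u, hu, hfu⟩ := hf (⟨0, rank_pos h⟩, false)
  obtain ⟨v, hv, hfv⟩ := hf (⟨0, rank_pos h⟩, true)
  refine ⟨_, _, ?_, ?_, ⟨u, Finset.mem_filter.2 ⟨hu, ?_⟩⟩, ⟨v, Finset.mem_filter.2 ⟨hv, ?_⟩⟩, hmem⟩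
  · refine Finset.disjoint_filter.2 fun x _ h1 h2 => ?_
    rw [← h1] at h2
    exact Bool.false_ne_true h2.symm
  · rw [← Finset.filter_or, Finset.filter_true_of_mem]
    · rfl
    · intro x _
      cases (f x).2 <;> simp
  · rw [hfu]
  · rw [hfv]

end Clutter

theorem mainTheorem4 {α : Type*} [DecidableEq α] (C : Clutter α)
    (hclean : C.IsClean) (htangled : C.IsTangled) :
    (∃ S : Finset (Fin C.rank → Bool), C.IsSetcore S) ∧
    ∀ S : Finset (Fin C.rank → Bool), C.IsSetcore S → IsSimplexSet (cubeConvexHull S) →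
      ((C.rank = 1 ∧ S = {fun _ => false, fun _ => true}) ∧
        ∃ U W : Finset α, Disjoint U W ∧ U ∪ W = C.ground ∧ U.Nonempty ∧ W.Nonempty ∧
          C.core.members = {U, W}) ∨
      (CubeSetIso S ({![false, false, false], ![true, true, false], ![true, false, true],
          ![false, true, true]} : Finset (Fin 3 → Bool)) ∧
        C.core.IsDuplicationOf Clutter.Q6) ∨
      ¬ C.IsIdeal := by
  refine ⟨htangled.exists_isSetcore hclean, fun S hS hsimplex => ?_⟩
  by_cases hI : C.IsIdeal
  · rcases htangled.setcore_classification hclean hI hS hsimplex with h | h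
    · exact Or.inl ⟨h, Clutter.isSetcore_partition htangled.ground_nonempty hS h.2⟩
    · refine Or.inr (Or.inl ⟨h, ?_⟩)
      have hd : C.core.IsDuplicationOf (Clutter.cuboid S) := hS
      exact (hd.trans (Clutter.cuboid_isDuplicationOf_of_cubeSetIso h)).trans
        Clutter.cuboid_isDuplicationOf_Q6
  · exact Or.inr (Or.inr hI)
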